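/- **Conventions.** All spaces are pointed topological spaces and all maps are continuous and preserve base points; homotopies are relative to the base point, and $I=[0,1]$. For a space $X$, $\mathbb{I}X=X\times I/(\{*\}\times I)$, $\mathrm{C}X=X\times I/(X\times\{0\}\cup\{*\}\times I)$ and $\Sigma X=X\times I/(X\times\{0,1\}\cup\{*\}\times I)$ denote the reduced cylinder, cone and suspension. For spaces $A$ and $X$ and $n\ge 0$ put $\pi^A_n(X)=[\Sigma^nA,X]$ (homotopy classes of maps). A map $f:X\to Y$ is an *$A$-weak equivalence* if $f_*:\pi^A_n(X)\to\pi^A_n(Y)$ is bijective for all $n\ge 0$. A map is an *$A$-fibration* if it has the homotopy lifting property (i.e. the right lifting property with respect to $i_0:Z\to\mathbb{I}Z$, $i_0(z)=[z,0]$) for $Z=A$, for $Z=\mathrm{C}\Sigma^{n-1}A$ and for $Z=\mathbb{I}^nA$, for all $n\ge 1$. A map is an *$A$-cofibration* if it has the left lifting property with respect to all maps that are both $A$-fibrations and $A$-weak equivalences. $\mathcal{T}op_A$ denotes the category of pointed topological spaces with these three classes. An *H-cogroup* is a space $A$ for which there are maps $\nu:A\to A\vee A$ and $\tau:A\to A$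 that satisfy the counit, coassociativity and coinverse laws up to homotopy. **Proposition.** Let $A$ be a compact Hausdorff H-cogroup. Let $L=-\wedge A$ (where $X\wedge A=X\times A/(X\times\{*\}\cup\{*\}\times A)$) and let $R=\mathrm{Hom}(A,-)$ be the space of pointed maps with the compact-open topology. Let $\varphi$ be the exponential law, that is, the adjunction $L\dashv R$ under which $f:X\wedge A\to Y$ corresponds to $x\mapsto(a\mapsto f[x,a])$. Then $(L,R,\varphi)$ is a Quillen adjunction between the model categories $\mathcal{T}op_{S^1}$ and $\mathcal{T}op_A$. That is, $\mathcal{T}op_{S^1}$ and $\mathcal{T}op_A$ are closed model categories, the functor $L:\mathcal{T}op_{S^1}\to\mathcal{T}op_A$ preserves cofibrations and trivial cofibrations, and the functor $R:\mathcal{T}op_A\to\mathcal{T}op_{S^1}$ preserves fibrations and trivial fibrations. Moreover, $R$ sends every $A$-weak equivalence to an $S^1$-weak equivalence. -/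

import Mathlib

open CategoryTheory

open scoped unitInterval

universe u

/-- A pointed topological space. -/
structure PointedTop : Type (u + 1) where
  carrier : Type u
  [top : TopologicalSpace carrier]
  pt : carrier

namespace PointedTop

instance : CoeSort PointedTop.{u} (Type u) := ⟨carrier⟩

instance (X : PointedTop.{u}) : TopologicalSpace X := X.top

/-- Base-point preserving continuous maps. -/
@[ext]
structure Hom (X Y : PointedTop.{u}) : Type u where
  map : C(X, Y)
  map_pt : map X.pt = Y.pt

/-- The category of pointed topological spaces. -/
instance : Category PointedTop.{u} where
  Hom := Hom
  id X := ⟨ContinuousMap.id X, rfl⟩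
  comp f g := ⟨g.map.comp f.map, by simp [f.map_pt, g.map_pt]⟩

@[ext]
theorem hom_ext {X Y : PointedTop.{u}} {f g : X ⟶ Y} (h : ∀ x, f.map x = g.map x) : f = g :=
  Hom.ext (ContinuousMap.ext h)

@[simp]
theorem id_map (X : PointedTop.{u}) (x : X) : Hom.map (𝟙 X) x = x := rfl

@[simp]
theorem comp_map {X Y Z : PointedTop.{u}} (f : X ⟶ Y) (g : Y ⟶ Z) (x : X) :
    (f ≫ g).map x = g.map (f.map x) := rfl

/-! ### Collapsing a subset to a point -/

/-- The equivalence relation on `Y` that identifies all points of `S` with each other. -/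
def collapseSetoid {Y : Type u} (S : Set Y) : Setoid Y where
  r x y := x = y ∨ (x ∈ S ∧ y ∈ S)
  iseqv :=
    { refl := fun _ => Or.inl rfl
      symm := by
        rintro x y (h | ⟨h, h'⟩)
        · exact Or.inl h.symm
        · exact Or.inr ⟨h', h⟩
      trans := by
        rintro x y z (rfl | ⟨h, h'⟩) (rfl | ⟨k, k'⟩)
        · exact Or.inl rfl
        · exact Or.inr ⟨k, k'⟩
        · exact Or.inr ⟨h, h'⟩
        · exact Or.inr ⟨h, k'⟩ }

/-- The quotient space `Y / S` with the quotient topology, pointed by the class of `s`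
(which is the point to which `S` is collapsed, as `s ∈ S`). -/
def collapse {Y : Type u} [TopologicalSpace Y] (S : Set Y) (s : Y) (_hs : s ∈ S) :
    PointedTop.{u} where
  carrier := Quotient (collapseSetoid S)
  pt := Quotient.mk _ s

section collapse

variable {Y : Type u} [TopologicalSpace Y] {S : Set Y} {s : Y} {hs : s ∈ S}

/-- The quotient map `Y → Y / S`. -/
def collapseMk (hs : s ∈ S) : C(Y, collapse S s hs) :=
  ⟨Quotient.mk (collapseSetoid S), continuous_quotient_mk'⟩

theorem collapseMk_surjective : Function.Surjective (collapseMk hs) := Quotient.mk_surjective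

theorem collapseMk_eq_pt {y : Y} (hy : y ∈ S) : collapseMk hs y = (collapse S s hs).pt :=
  Quotient.sound (Or.inr ⟨hy, hs⟩)

/-- A continuous map that sends `S` to the base point descends to `Y / S`. -/
def collapseDesc {Z : PointedTop.{u}} (f : C(Y, Z)) (hf : ∀ y ∈ S, f y = Z.pt) :
    collapse S s hs ⟶ Z where
  map :=
    ⟨Quotient.lift f (by
        rintro x y (rfl | ⟨hx, hy⟩)
        · rfl
        · rw [hf x hx, hf y hy]),
      f.continuous.quotient_lift _⟩
  map_pt := hf s hs

@[simp]
theorem collapseDesc_mk {Z : PointedTop.{u}} (f : C(Y, Z)) (hf : ∀ y ∈ S, f y = Z.pt) (y : Y) :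
    (collapseDesc (hs := hs) f hf).map (collapseMk hs y) = f y := rfl

end collapse

/-! ### Reduced cylinder, cone, suspension -/

/-- The reduced cylinder `X × I / {*} × I`. -/
def cyl (X : PointedTop.{u}) : PointedTop.{u} :=
  collapse {p : X × I | p.1 = X.pt} (X.pt, 0) rfl

/-- The inclusion `x ↦ [x, 0]` into the bottom of the reduced cylinder. -/
def cylBottom (X : PointedTop.{u}) : X ⟶ cyl X where
  map := (collapseMk _).comp ⟨fun x => (x, 0), by fun_prop⟩
  map_pt := rfl

/-- The reduced cone `X × I / (X × {0} ∪ {*} × I)`. -/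
def cone (X : PointedTop.{u}) : PointedTop.{u} :=
  collapse {p : X × I | p.1 = X.pt ∨ p.2 = 0} (X.pt, 0) (Or.inl rfl)

/-- The reduced suspension `X × I / (X × {0, 1} ∪ {*} × I)`. -/
def susp (X : PointedTop.{u}) : PointedTop.{u} :=
  collapse {p : X × I | p.1 = X.pt ∨ p.2 = 0 ∨ p.2 = 1} (X.pt, 0) (Or.inl rfl)

/-- The iterated suspension `Σⁿ X`. -/
def iterSusp (X : PointedTop.{u}) : ℕ → PointedTop.{u}
  | 0 => X
  | n + 1 => susp (iterSusp X n)

/-- The iterated reduced cylinder. -/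
def iterCyl (X : PointedTop.{u}) : ℕ → PointedTop.{u}
  | 0 => X
  | n + 1 => cyl (iterCyl X n)

/-- The circle `S¹` (in an arbitrary universe), pointed by `1`. -/
noncomputable def circle : PointedTop.{u} where
  carrier := ULift.{u} Circle
  pt := ⟨1⟩

/-! ### Homotopy classes and homotopy groups with coefficients -/

/-- Pointed homotopy. -/
def Homotopic {X Y : PointedTop.{u}} (f g : X ⟶ Y) : Prop :=
  f.map.HomotopicRel g.map {X.pt}

theorem Homotopic.comp_right {X Y Z : PointedTop.{u}} {f g : X ⟶ Y} (h : Homotopic f g)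
    (k : Y ⟶ Z) : Homotopic (f ≫ k) (g ≫ k) :=
  ContinuousMap.HomotopicRel.comp_continuousMap h k.map

/-- Pointed homotopy as an equivalence relation on pointed maps. -/
def homotopicSetoid (X Y : PointedTop.{u}) : Setoid (X ⟶ Y) where
  r := Homotopic
  iseqv :=
    { refl := fun f => ContinuousMap.HomotopicRel.refl f.map
      symm := fun h => ContinuousMap.HomotopicRel.symm h
      trans := fun h k => ContinuousMap.HomotopicRel.trans h k }

/-- `πᴬₙ(X) = [Σⁿ A, X]`, the set of pointed homotopy classes. -/
def homotopySet (A : PointedTop.{u}) (n : ℕ) (X : PointedTop.{u}) : Type u :=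
  Quotient (homotopicSetoid (iterSusp A n) X)

/-- The map `f_* : πᴬₙ(X) → πᴬₙ(Y)` induced by `f : X ⟶ Y`. -/
def homotopySetMap (A : PointedTop.{u}) (n : ℕ) {X Y : PointedTop.{u}} (f : X ⟶ Y) :
    homotopySet A n X → homotopySet A n Y :=
  Quotient.map (· ≫ f) fun _ _ h => Homotopic.comp_right h f

/-! ### Wedges and H-cogroups -/

/-- The wedge `X ∨ Y`. -/
def wedge (X Y : PointedTop.{u}) : PointedTop.{u} :=
  collapse ({Sum.inl X.pt, Sum.inr Y.pt} : Set (X ⊕ Y)) (Sum.inl X.pt) (Or.inl rfl)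

/-- The inclusion of the first summand into the wedge. -/
def wedgeInl (X Y : PointedTop.{u}) : X ⟶ wedge X Y where
  map := (collapseMk _).comp ⟨Sum.inl, continuous_inl⟩
  map_pt := rfl

/-- The inclusion of the second summand into the wedge. -/
def wedgeInr (X Y : PointedTop.{u}) : Y ⟶ wedge X Y where
  map := (collapseMk _).comp ⟨Sum.inr, continuous_inr⟩
  map_pt := collapseMk_eq_pt (Or.inr rfl)

/-- The map `X ∨ Y ⟶ Z` given by `f` on `X` and by `g` on `Y`. -/
def wedgeDesc {X Y Z : PointedTop.{u}} (f : X ⟶ Z) (g : Y ⟶ Z) : wedge X Y ⟶ Z :=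
  collapseDesc ⟨Sum.elim f.map g.map, by fun_prop⟩ (by
    rintro y (rfl | rfl)
    · exact f.map_pt
    · exact g.map_pt)

/-- The constant map to the base point. -/
def trivialMap (X Y : PointedTop.{u}) : X ⟶ Y where
  map := ContinuousMap.const X Y.pt
  map_pt := rfl

/-- `A` is an H-cogroup: there are a comultiplication `ν : A ⟶ A ∨ A` and a coinverse
`τ : A ⟶ A` which satisfy the counit, coassociativity and coinverse laws up to pointed
homotopy. -/
def IsHCogroup (A : PointedTop.{u}) : Prop :=
  ∃ (ν : A ⟶ wedge A A) (τ : A ⟶ A),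
    Homotopic (ν ≫ wedgeDesc (𝟙 A) (trivialMap A A)) (𝟙 A) ∧
    Homotopic (ν ≫ wedgeDesc (trivialMap A A) (𝟙 A)) (𝟙 A) ∧
    -- `(ν ∨ id) ν ≃ (id ∨ ν) ν`, both read in the triple wedge `A ∨ (A ∨ A)`
    Homotopic
      (ν ≫ wedgeDesc
        (ν ≫ wedgeDesc (wedgeInl A (wedge A A)) (wedgeInl A A ≫ wedgeInr A (wedge A A)))
        (wedgeInr A A ≫ wedgeInr A (wedge A A)))
      (ν ≫ wedgeDesc (wedgeInl A (wedge A A)) (ν ≫ wedgeInr A (wedge A A))) ∧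
    Homotopic (ν ≫ wedgeDesc (𝟙 A) τ) (trivialMap A A) ∧
    Homotopic (ν ≫ wedgeDesc τ (𝟙 A)) (trivialMap A A)

/-! ### The `A`-based classes of maps -/

/-- The homotopy lifting property of `p` with respect to `Z`, in the pointed category. -/
def HasHLP {E B : PointedTop.{u}} (p : E ⟶ B) (Z : PointedTop.{u}) : Prop :=
  HasLiftingProperty (cylBottom Z) p

/-- The `A`-fibrations. -/
def fib (A : PointedTop.{u}) : MorphismProperty PointedTop.{u} := fun _ _ p =>
  HasHLP p A ∧ (∀ n : ℕ, HasHLP p (cone (iterSusp A n))) ∧ (∀ n : ℕ, HasHLP p (iterCyl A (n + 1)))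

/-- The `A`-weak equivalences. -/
def weq (A : PointedTop.{u}) : MorphismProperty PointedTop.{u} := fun _ _ f =>
  ∀ n : ℕ, Function.Bijective (homotopySetMap A n f)

/-- The `A`-cofibrations: the left lifting property against the maps that are both
`A`-fibrations and `A`-weak equivalences. -/
def cof (A : PointedTop.{u}) : MorphismProperty PointedTop.{u} :=
  (fib A ⊓ weq A).llp

/-! ### The smash product and the space of pointed maps -/

/-- The smash product `X ∧ A = X × A / (X × {*} ∪ {*} × A)`. -/
def smash (X A : PointedTop.{u}) : PointedTop.{u} :=
  collapse {p : X × A | p.1 = X.pt ∨ p.2 = A.pt} (X.pt, A.pt) (Or.inl rfl)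

/-- The quotient map `X × A → X ∧ A`. -/
def smashMk (X A : PointedTop.{u}) : C(X × A, smash X A) :=
  collapseMk _

theorem smashMk_surjective (X A : PointedTop.{u}) : Function.Surjective (smashMk X A) :=
  collapseMk_surjective

/-- The functor `- ∧ A`. -/
def smashFunctor (A : PointedTop.{u}) : PointedTop.{u} ⥤ PointedTop.{u} where
  obj X := smash X A
  map {X Y} f := collapseDesc
    ((smashMk Y A).comp (f.map.prodMap (ContinuousMap.id A))) (by
      rintro ⟨x, a⟩ (rfl | rfl)
      · exact collapseMk_eq_pt (Or.inl f.map_pt)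
      · exact collapseMk_eq_pt (Or.inr rfl))
  map_id X := by
    ext x
    obtain ⟨x, rfl⟩ := collapseMk_surjective x
    rfl
  map_comp f g := by
    ext x
    obtain ⟨x, rfl⟩ := collapseMk_surjective x
    rfl

/-- The compact-open topology on the set of pointed maps. -/
instance (A X : PointedTop.{u}) : TopologicalSpace (Hom A X) :=
  TopologicalSpace.induced Hom.map inferInstance

/-- The space `Hom(A, X)` of pointed maps with the compact-open topology, pointed by the
constant map. -/
def mapSpace (A X : PointedTop.{u}) : PointedTop.{u} where
  carrier := Hom A X
  pt := trivialMap A X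

theorem continuous_hom_map (A X : PointedTop.{u}) : Continuous (Hom.map : Hom A X → C(A, X)) :=
  continuous_induced_dom

/-- The functor `Hom(A, -)`. -/
def homFunctor (A : PointedTop.{u}) : PointedTop.{u} ⥤ PointedTop.{u} where
  obj X := mapSpace A X
  map {X Y} f :=
    { map :=
        ⟨fun g : Hom A X => (⟨f.map.comp g.map, by simp [g.map_pt, f.map_pt]⟩ : Hom A Y),
          continuous_induced_rng.2
            ((ContinuousMap.continuous_postcomp f.map).comp (continuous_hom_map A X))⟩
      map_pt := Hom.ext (ContinuousMap.ext fun _ => f.map_pt) }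
  map_id _ := rfl
  map_comp _ _ := rfl

/-- One half of the exponential law: `f : X ∧ A ⟶ Y` corresponds to `x ↦ (a ↦ f [x, a])`. -/
def curry {A X Y : PointedTop.{u}} (f : smash X A ⟶ Y) : X ⟶ mapSpace A Y where
  map :=
    ⟨fun x => (⟨(f.map.comp (smashMk X A)).curry x,
        (congrArg f.map (collapseMk_eq_pt (Or.inr rfl))).trans f.map_pt⟩ : Hom A Y),
      continuous_induced_rng.2 (f.map.comp (smashMk X A)).curry.continuous⟩
  map_pt := Hom.ext (ContinuousMap.ext fun _ =>
    (congrArg f.map (collapseMk_eq_pt (Or.inl rfl))).trans f.map_pt)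

/-- The other half of the exponential law: `g : X ⟶ Hom(A, Y)` corresponds to
`[x, a] ↦ g x a`. -/
def uncurry {A X Y : PointedTop.{u}} [LocallyCompactSpace A] (g : X ⟶ mapSpace A Y) :
    smash X A ⟶ Y :=
  collapseDesc
    (ContinuousMap.uncurry
      ⟨fun x => Hom.map (g.map x), (continuous_hom_map A Y).comp g.map.continuous⟩) (by
      rintro ⟨x, a⟩ (rfl | rfl)
      · exact congrArg (fun h : Hom A Y => h.map a) g.map_pt
      · exact Hom.map_pt (g.map x))

/-- The exponential law: `- ∧ A` is left adjoint to `Hom(A, -)`. -/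
def smashHomAdjunction (A : PointedTop.{u}) [LocallyCompactSpace A] :
    smashFunctor A ⊣ homFunctor A :=
  Adjunction.mkOfHomEquiv
    { homEquiv := fun X Y =>
        { toFun := fun f => curry f
          invFun := fun g => uncurry g
          left_inv := fun f => by
            apply hom_ext
            intro z
            obtain ⟨z, rfl⟩ := collapseMk_surjective z
            rfl
          right_inv := fun _ => rfl }
      homEquiv_naturality_left_symm := fun f g => by
        apply hom_ext
        intro z
        obtain ⟨z, rfl⟩ := smashMk_surjective _ _ z
        rfl
      homEquiv_naturality_right := fun _ _ => rfl }

end PointedTop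

/-! ### Model structures and Quillen adjunctions -/

/-- The classes `F` (fibrations), `K` (cofibrations) and `W` (weak equivalences) make `C` a
closed model category. -/
def IsModelStructure {C : Type*} [Category C] (F K W : MorphismProperty C) : Prop :=
  ∃ _ : HomotopicalAlgebra.ModelCategory C,
    HomotopicalAlgebra.fibrations C = F ∧
    HomotopicalAlgebra.cofibrations C = K ∧
    HomotopicalAlgebra.weakEquivalences C = W

/-- The adjunction `L ⊣ R` is a Quillen adjunction from the model category
`(C, F, K, W)` to the model category `(D, F', K', W')`. -/
structure IsQuillenAdjunction {C D : Type*} [Category C] [Category D]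
    (F K W : MorphismProperty C) (F' K' W' : MorphismProperty D)
    {L : C ⥤ D} {R : D ⥤ C} (_adj : L ⊣ R) : Prop where
  source : IsModelStructure F K W
  target : IsModelStructure F' K' W'
  left_cof : ∀ ⦃X Y : C⦄ (f : X ⟶ Y), K f → K' (L.map f)
  left_trivialCof : ∀ ⦃X Y : C⦄ (f : X ⟶ Y), (K ⊓ W) f → (K' ⊓ W') (L.map f)
  right_fib : ∀ ⦃X Y : D⦄ (f : X ⟶ Y), F' f → F (R.map f)
  right_trivialFib : ∀ ⦃X Y : D⦄ (f : X ⟶ Y), (F' ⊓ W') f → (F ⊓ W) (R.map f)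

/-! Everything is transposed to path spaces. Maps out of a cylinder, cone or suspension of `Z` are
maps from `Z` into free paths, based paths or loops, and maps out of `A` are points of `Hom(A, -)`,
that is, maps from the two-point space `S⁰`. An `Exchange` records such a bijection together with
the fact that the functor commutes with free paths; it carries homotopy lifting, lifting with
prescribed ends, and bijectivity on homotopy classes from one side to the other. Hence `p` is an
`A`-fibration or an `A`-weak equivalence iff `Hom(A, p)` is one for `S⁰`, and a map `q` is one for
`S¹` iff its loop map `Ωq` is one for `S⁰`. Since `Ω` preserves both classes, `Hom(A, -)` sends them
to the corresponding classes for `S¹` (`fib.map_hom`, `weq.map_hom`). The left adjoint is then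
handled by lifting properties, once both model structures exist.

For the model structure, the cube conditions already imply the cone condition, because two explicit
deformations of the square give relative homotopy lifting (`exists_square_lift`, `fib_iff`). The
trivial fibrations should be the maps with the right lifting property against a small set: the base
point of each `ΣⁿA`, both ends of its cylinder, and the bottoms of the cubes. All these maps are
embeddings, every space is small relative to embeddings, and so the small object argument gives one
factorization. The other one comes from the mapping path space, and trivial cofibrations lift
against fibrations because they are deformation retracts (`trivialCof_hasLiftingProperty`).

The delicate point is that a trivial fibration lifts homotopies with prescribed ends (`Full`).
Homotopy sets are based, so the hypothesis on `P = Hom(A, p)` says something about `π₁` only at the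
constant map. The H-cogroup structure makes `Hom(A, E)` an H-group: subtracting `y` moves the
component of `y` to that of the constant map, compatibly with `P`, and adding `y` moves it back up
to homotopy (`exists_translation`). A path between images thus lifts up to homotopy relative to its
ends, and the fibration property makes the lift strict (`full_twoPoint`). The circle is itself an
H-cogroup, by concatenation and reversal of loops, so the same theorem covers the source. -/

namespace PointedTop

/-! ### Spaces of paths that are trivial on a prescribed set of times -/

/-- The space of paths in `X` that are at the base point at all times in `C`. -/
def relPath (C : Set I) (X : PointedTop.{u}) : PointedTop.{u} where
  carrier := {γ : C(I, X) // ∀ c ∈ C, γ c = X.pt}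
  pt := ⟨ContinuousMap.const I X.pt, fun _ _ => rfl⟩

section relPath

variable {C : Set I} {X Y Z : PointedTop.{u}}

@[ext]
theorem relPath_ext {γ δ : relPath C X} (h : ∀ t, γ.1 t = δ.1 t) : γ = δ :=
  Subtype.ext (ContinuousMap.ext h)

@[simp]
theorem relPath_pt_apply (t : I) : (relPath C X).pt.1 t = X.pt := rfl

theorem continuous_relPath_iff {T : Type*} [TopologicalSpace T] {f : T → relPath C X} :
    Continuous f ↔ Continuous fun q : T × I => (f q.1).1 q.2 := by
  constructor
  · intro h
    have h1 : Continuous fun q : T × I => ((f q.1).1 : C(I, X)) :=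
      continuous_subtype_val.comp (h.comp continuous_fst)
    exact h1.eval continuous_snd
  · intro h
    exact Continuous.subtype_mk
      (ContinuousMap.continuous_of_continuous_uncurry (fun t => (f t).1) h) _

theorem continuous_relPath_eval : Continuous fun q : relPath C X × I => q.1.1 q.2 :=
  continuous_relPath_iff.1 continuous_id

theorem Continuous.relPath_apply {T : Type*} [TopologicalSpace T] {f : T → relPath C X}
    (hf : Continuous f) {g : T → I} (hg : Continuous g) : Continuous fun t => (f t).1 (g t) :=
  continuous_relPath_eval.comp (hf.prodMk hg)

/-- A pointed map into a path space from its uncurried form. -/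
def toRel (F : C(Z × I, X)) (h : ∀ t, F (Z.pt, t) = X.pt)
    (hC : ∀ z, ∀ c ∈ C, F (z, c) = X.pt) : Z ⟶ relPath C X where
  map := ⟨fun z => ⟨F.curry z, hC z⟩, F.curry.continuous.subtype_mk _⟩
  map_pt := relPath_ext h

theorem hom_relPath_ext {f g : Z ⟶ relPath C X} (h : ∀ z t, (f.map z).1 t = (g.map z).1 t) :
    f = g :=
  hom_ext fun z => relPath_ext (h z)

theorem relPath_map_pt (f : Z ⟶ relPath C X) (t : I) : (f.map Z.pt).1 t = X.pt := by
  rw [f.map_pt]; rfl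

/-- The uncurried form of a map into a path space. -/
def ofRel (f : Z ⟶ relPath C X) : C(Z × I, X) :=
  ⟨fun q => (f.map q.1).1 q.2, continuous_relPath_iff.1 f.map.continuous⟩

/-- The functor that sends a space to its space of paths trivial on `C`. -/
def relPathFunctor (C : Set I) : PointedTop.{u} ⥤ PointedTop.{u} where
  obj X := relPath C X
  map f := toRel ⟨fun q => f.map (q.1.1 q.2), f.map.continuous.comp continuous_relPath_eval⟩
    (fun _ => f.map_pt) (fun z c hc => (congrArg f.map (z.2 c hc)).trans f.map_pt)
  map_id _ := rfl
  map_comp _ _ := rfl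

/-- Evaluation at a time. -/
def ev (C : Set I) (X : PointedTop.{u}) (t : I) : relPath C X ⟶ X where
  map := ⟨fun γ => γ.1 t, Continuous.relPath_apply continuous_id continuous_const⟩
  map_pt := rfl

/-- Exchange of the two time coordinates. -/
def relPathSwap (C D : Set I) (X : PointedTop.{u}) :
    relPath C (relPath D X) ⟶ relPath D (relPath C X) where
  map := ⟨fun γ => ⟨⟨fun t => ⟨⟨fun s => (γ.1 s).1 t,
      Continuous.relPath_apply γ.1.continuous continuous_const⟩,
      fun c hc => by simp [γ.2 c hc]⟩,
      continuous_relPath_iff.2 (Continuous.relPath_apply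
        (γ.1.continuous.comp continuous_snd) continuous_fst)⟩,
      fun c hc => relPath_ext fun s => (γ.1 s).2 c hc⟩,
      continuous_relPath_iff.2 <| continuous_relPath_iff.2 <|
        Continuous.relPath_apply (Continuous.relPath_apply
          (continuous_fst.comp continuous_fst) continuous_snd)
          (continuous_snd.comp continuous_fst)⟩
  map_pt := rfl

/-- Path space functors commute with each other. -/
def relPathSwapIso (C D : Set I) :
    relPathFunctor.{u} D ⋙ relPathFunctor C ≅ relPathFunctor C ⋙ relPathFunctor D :=
  NatIso.ofComponents
    (fun X => ⟨relPathSwap C D X, relPathSwap D C X, rfl, rfl⟩) (fun _ => rfl)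

end relPath

section mapSpace

variable {A X Y Z : PointedTop.{u}}

theorem continuous_mapSpace_iff [LocallyCompactSpace A] {T : Type*} [TopologicalSpace T]
    {f : T → mapSpace A X} :
    Continuous f ↔ Continuous fun q : T × A => Hom.map (f q.1) q.2 := by
  constructor
  · intro h
    have h1 : Continuous fun q : T × A => (Hom.map (f q.1) : C(A, X)) :=
      (continuous_hom_map A X).comp (h.comp continuous_fst)
    exact h1.eval continuous_snd
  · intro h
    exact continuous_induced_rng.2
      (ContinuousMap.continuous_of_continuous_uncurry (fun t => Hom.map (f t)) h)

theorem Continuous.mapSpace_apply [LocallyCompactSpace A] {T : Type*} [TopologicalSpace T]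
    {f : T → mapSpace A X} (hf : Continuous f) {g : T → A} (hg : Continuous g) :
    Continuous fun t => Hom.map (f t) (g t) :=
  (continuous_mapSpace_iff.1 continuous_id).comp (hf.prodMk hg)

/-- Families of pointed maps parametrized by paths versus paths of pointed maps. -/
def mapSpaceRelPath (A X : PointedTop.{u}) [LocallyCompactSpace A] (C : Set I) :
    mapSpace A (relPath C X) ⟶ relPath C (mapSpace A X) where
  map := ⟨fun f : Hom A (relPath C X) => ⟨⟨fun t => (f ≫ ev C X t : A ⟶ X),
      continuous_mapSpace_iff.2 (Continuous.relPath_apply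
        (f.map.continuous.comp continuous_snd) continuous_fst)⟩,
      fun c hc => hom_ext fun a => (f.map a).2 c hc⟩,
      continuous_relPath_iff.2 <| continuous_mapSpace_iff.2 <|
        Continuous.relPath_apply (Continuous.mapSpace_apply
          (continuous_fst.comp continuous_fst) continuous_snd)
          (continuous_snd.comp continuous_fst)⟩
  map_pt := rfl

/-- The inverse of `mapSpaceRelPath`. -/
def relPathMapSpace (A X : PointedTop.{u}) [LocallyCompactSpace A] (C : Set I) :
    relPath C (mapSpace A X) ⟶ mapSpace A (relPath C X) where
  map := ⟨fun γ => (toRel ⟨fun q => Hom.map (γ.1 q.2) q.1,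
        Continuous.mapSpace_apply (γ.1.continuous.comp continuous_snd) continuous_fst⟩
        (fun t => Hom.map_pt (γ.1 t))
        (fun a c hc => by
          change Hom.map (γ.1 c) a = _
          rw [γ.2 c hc]; rfl) : A ⟶ relPath C X),
      continuous_mapSpace_iff.2 <| continuous_relPath_iff.2 <|
        Continuous.mapSpace_apply (Continuous.relPath_apply
          (continuous_fst.comp continuous_fst) continuous_snd)
          (continuous_snd.comp continuous_fst)⟩
  map_pt := rfl

/-- The functor `Hom(A, -)` commutes with path spaces. -/
def mapSpaceRelPathIso (A : PointedTop.{u}) [LocallyCompactSpace A] (C : Set I) :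
    relPathFunctor C ⋙ homFunctor A ≅ homFunctor A ⋙ relPathFunctor C :=
  NatIso.ofComponents
    (fun X => ⟨mapSpaceRelPath A X C, relPathMapSpace A X C, rfl, rfl⟩) (fun _ => rfl)

end mapSpace

/-! ### Lifting properties and homotopy classes in terms of path spaces -/

/-- The free path space functor. -/
abbrev pathFunctor : PointedTop.{u} ⥤ PointedTop.{u} := relPathFunctor ∅

/-- The free path space. -/
abbrev path (X : PointedTop.{u}) : PointedTop.{u} := pathFunctor.obj X

/-- Evaluation of free paths. -/
abbrev pathEv (X : PointedTop.{u}) (t : I) : path X ⟶ X := ev ∅ X t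

section

variable {X Y Z Z' E B : PointedTop.{u}}

/-- A map into the free path space from its uncurried form. -/
abbrev toPath (F : C(Z × I, X)) (h : ∀ t, F (Z.pt, t) = X.pt) : Z ⟶ path X :=
  toRel F h (by simp)

theorem pathFunctor_map_ev (p : E ⟶ B) (t : I) :
    pathFunctor.map p ≫ pathEv B t = pathEv E t ≫ p := rfl

theorem homotopic_iff {f g : X ⟶ Y} :
    Homotopic f g ↔ ∃ G : X ⟶ path Y, G ≫ pathEv Y 0 = f ∧ G ≫ pathEv Y 1 = g := by
  constructor
  · rintro ⟨H⟩
    refine ⟨toPath ⟨fun q => H (q.2, q.1), by fun_prop⟩ (fun t => ?_), ?_, ?_⟩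
    · exact (H.eq_fst t rfl).trans f.map_pt
    · exact hom_ext fun x => H.apply_zero x
    · exact hom_ext fun x => H.apply_one x
  · rintro ⟨G, rfl, rfl⟩
    exact ⟨{
      toFun := fun q => (G.map q.2).1 q.1
      continuous_toFun := (ofRel G).continuous.comp continuous_swap
      map_zero_left := fun _ => rfl
      map_one_left := fun _ => rfl
      prop' := by
        rintro t x rfl
        exact (relPath_map_pt G t).trans (relPath_map_pt G 0).symm }⟩

/-- The homotopy lifting property in curried form. -/
def HLP (Z : PointedTop.{u}) {E B : PointedTop.{u}} (p : E ⟶ B) : Prop :=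
  ∀ (f : Z ⟶ E) (G : Z ⟶ path B), G ≫ pathEv B 0 = f ≫ p →
    ∃ F : Z ⟶ path E, F ≫ pathEv E 0 = f ∧ F ≫ pathFunctor.map p = G

/-- Homotopies `Z → B^I` between maps which lift to `E` lift, with prescribed ends. -/
def Full (Z : PointedTop.{u}) {E B : PointedTop.{u}} (p : E ⟶ B) : Prop :=
  ∀ (f g : Z ⟶ E) (G : Z ⟶ path B), G ≫ pathEv B 0 = f ≫ p → G ≫ pathEv B 1 = g ≫ p →
    ∃ F : Z ⟶ path E, F ≫ pathEv E 0 = f ∧ F ≫ pathEv E 1 = g ∧ F ≫ pathFunctor.map p = G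

/-- The map `[Z, E] → [Z, B]` is bijective. -/
def Bij (Z : PointedTop.{u}) {E B : PointedTop.{u}} (p : E ⟶ B) : Prop :=
  (∀ f g : Z ⟶ E, Homotopic (f ≫ p) (g ≫ p) → Homotopic f g) ∧
    ∀ b : Z ⟶ B, ∃ f : Z ⟶ E, Homotopic (f ≫ p) b

theorem bij_iff (A : PointedTop.{u}) (n : ℕ) (p : E ⟶ B) :
    Function.Bijective (homotopySetMap A n p) ↔ Bij (iterSusp A n) p := by
  refine and_congr ⟨fun h f g hfg => ?_, ?_⟩ ⟨fun h b => ?_, ?_⟩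
  · exact Quotient.exact (s := homotopicSetoid _ _)
      (@h (Quotient.mk _ f) (Quotient.mk _ g) (Quotient.sound hfg))
  · rintro h ⟨f⟩ ⟨g⟩ hfg
    exact Quotient.sound (h f g (Quotient.exact (s := homotopicSetoid _ _) hfg))
  · obtain ⟨⟨f⟩, hf⟩ := h (Quotient.mk _ b)
    exact ⟨f, Quotient.exact (s := homotopicSetoid _ _) hf⟩
  · rintro h ⟨b⟩
    obtain ⟨f, hf⟩ := h b
    exact ⟨Quotient.mk _ f, Quotient.sound hf⟩

theorem weq_iff {A : PointedTop.{u}} {p : E ⟶ B} : weq A p ↔ ∀ n, Bij (iterSusp A n) p :=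
  forall_congr' fun n => bij_iff A n p

/-! ### Quotients of `Z × I` and path spaces -/

section collapse

variable {C : Set I} {S : Set (Z × I)} {s : Z × I} {hs : s ∈ S}

/-- Maps out of `Z × I / ({*} × I ∪ Z × C)` are maps from `Z` into the path space. -/
def collapseEquiv (hS : ∀ q, q ∈ S ↔ q.1 = Z.pt ∨ q.2 ∈ C) (X : PointedTop.{u}) :
    (collapse S s hs ⟶ X) ≃ (Z ⟶ (relPathFunctor C).obj X) where
  toFun f := toRel (f.map.comp (collapseMk hs))
    (fun t => (congrArg f.map (collapseMk_eq_pt ((hS _).2 (Or.inl rfl)))).trans f.map_pt)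
    (fun z c hc => (congrArg f.map (collapseMk_eq_pt ((hS _).2 (Or.inr hc)))).trans f.map_pt)
  invFun g := collapseDesc (ofRel g) (by
    rintro ⟨z, t⟩ h
    obtain h | h := (hS _).1 h
    · obtain rfl : z = Z.pt := h
      exact relPath_map_pt g t
    · exact (g.map z).2 t h)
  left_inv f := hom_ext fun x => by
    obtain ⟨x, rfl⟩ := collapseMk_surjective x
    rfl
  right_inv g := rfl

end collapse

/-! ### Transposing lifting problems and homotopy classes. -/

/-- A functor that commutes with free path spaces. -/
structure PathComm (G : PointedTop.{u} ⥤ PointedTop.{u}) where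
  /-- the isomorphism -/
  iso (X : PointedTop.{u}) : G.obj (path X) ≅ path (G.obj X)
  iso_ev (X : PointedTop.{u}) (t : I) : (iso X).hom ≫ pathEv (G.obj X) t = G.map (pathEv X t)
  iso_map {X Y : PointedTop.{u}} (f : X ⟶ Y) :
    G.map (pathFunctor.map f) ≫ (iso Y).hom = (iso X).hom ≫ pathFunctor.map (G.map f)

/-- Maps out of `Z'` are maps from `Z` into the value of a functor which commutes with path
spaces. -/
structure Exchange (Z' Z : PointedTop.{u}) (G : PointedTop.{u} ⥤ PointedTop.{u}) extends
    PathComm G where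
  /-- the bijection -/
  equiv (X : PointedTop.{u}) : (Z' ⟶ X) ≃ (Z ⟶ G.obj X)
  equiv_comp {X Y : PointedTop.{u}} (f : Z' ⟶ X) (g : X ⟶ Y) :
    equiv Y (f ≫ g) = equiv X f ≫ G.map g

namespace Exchange

variable {G : PointedTop.{u} ⥤ PointedTop.{u}} (e : Exchange Z' Z G)

/-- The bijection on homotopies. -/
def pathEquiv (X : PointedTop.{u}) : (Z' ⟶ path X) ≃ (Z ⟶ path (G.obj X)) :=
  (e.equiv (path X)).trans (Iso.homToEquiv (e.iso X))

theorem pathEquiv_apply (F : Z' ⟶ path X) :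
    e.pathEquiv X F = e.equiv (path X) F ≫ (e.iso X).hom := rfl

theorem pathEquiv_ev (F : Z' ⟶ path X) (t : I) :
    e.pathEquiv X F ≫ pathEv (G.obj X) t = e.equiv X (F ≫ pathEv X t) := by
  rw [pathEquiv_apply, Category.assoc, e.iso_ev, e.equiv_comp]

theorem pathEquiv_map (F : Z' ⟶ path X) (p : X ⟶ Y) :
    e.pathEquiv Y (F ≫ pathFunctor.map p) =
      e.pathEquiv X F ≫ pathFunctor.map (G.map p) := by
  rw [pathEquiv_apply, pathEquiv_apply, e.equiv_comp, Category.assoc, Category.assoc, e.iso_map]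

theorem hlp_iff (e : Exchange Z' Z G) (p : E ⟶ B) : HLP Z' p ↔ HLP Z (G.map p) := by
  refine (e.equiv E).forall_congr fun {f} => (e.pathEquiv B).forall_congr fun {H} => ?_
  rw [e.pathEquiv_ev, ← e.equiv_comp, (e.equiv B).apply_eq_iff_eq]
  refine imp_congr_right fun _ => (e.pathEquiv E).exists_congr fun {F} => ?_
  rw [e.pathEquiv_ev, ← e.pathEquiv_map, (e.equiv E).apply_eq_iff_eq,
    (e.pathEquiv B).apply_eq_iff_eq]

theorem full_iff (e : Exchange Z' Z G) (p : E ⟶ B) : Full Z' p ↔ Full Z (G.map p) := by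
  refine (e.equiv E).forall_congr fun {f} => (e.equiv E).forall_congr fun {g} =>
    (e.pathEquiv B).forall_congr fun {H} => ?_
  rw [e.pathEquiv_ev, e.pathEquiv_ev, ← e.equiv_comp, ← e.equiv_comp,
    (e.equiv B).apply_eq_iff_eq, (e.equiv B).apply_eq_iff_eq]
  refine imp_congr_right fun _ => imp_congr_right fun _ =>
    (e.pathEquiv E).exists_congr fun {F} => ?_
  rw [e.pathEquiv_ev, e.pathEquiv_ev, ← e.pathEquiv_map, (e.equiv E).apply_eq_iff_eq,
    (e.equiv E).apply_eq_iff_eq, (e.pathEquiv B).apply_eq_iff_eq]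

theorem homotopic_iff (f g : Z' ⟶ X) :
    Homotopic f g ↔ Homotopic (e.equiv X f) (e.equiv X g) := by
  rw [PointedTop.homotopic_iff, PointedTop.homotopic_iff]
  refine (e.pathEquiv X).exists_congr fun {F} => ?_
  rw [e.pathEquiv_ev, e.pathEquiv_ev, (e.equiv X).apply_eq_iff_eq, (e.equiv X).apply_eq_iff_eq]

theorem bij_iff (e : Exchange Z' Z G) (p : E ⟶ B) : Bij Z' p ↔ Bij Z (G.map p) := by
  refine and_congr ((e.equiv E).forall_congr fun {f} => (e.equiv E).forall_congr fun {g} => ?_)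
    ((e.equiv B).forall_congr fun {b} => (e.equiv E).exists_congr fun {f} => ?_)
  · rw [← e.equiv_comp, ← e.equiv_comp, ← e.homotopic_iff, ← e.homotopic_iff]
  · rw [← e.equiv_comp, ← e.homotopic_iff]

end Exchange

/-- Path spaces commute with path spaces. -/
def relPathComm (C : Set I) : PathComm.{u} (relPathFunctor C) where
  iso X := (relPathSwapIso C ∅).app X
  iso_ev _ _ := rfl
  iso_map _ := rfl

/-- The exchange for a quotient of `Z × I`. -/
def collapseExchange {C : Set I} {S : Set (Z × I)} {s : Z × I} {hs : s ∈ S}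
    (hS : ∀ q, q ∈ S ↔ q.1 = Z.pt ∨ q.2 ∈ C) :
    Exchange (collapse S s hs) Z (relPathFunctor C) where
  toPathComm := relPathComm C
  equiv := collapseEquiv hS
  equiv_comp _ _ := rfl

/-- Maps out of a cylinder are maps into the free path space. -/
def cylExchange (Z : PointedTop.{u}) : Exchange (cyl Z) Z pathFunctor :=
  collapseExchange (by simp)

/-- Maps out of a cone are maps into the space of based paths. -/
def coneExchange (Z : PointedTop.{u}) : Exchange (cone Z) Z (relPathFunctor {0}) :=
  collapseExchange (by simp)

/-- The loop space functor. -/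
abbrev loopFunctor : PointedTop.{u} ⥤ PointedTop.{u} := relPathFunctor {0, 1}

/-- Maps out of a suspension are maps into the loop space. -/
def suspExchange (Z : PointedTop.{u}) : Exchange (susp Z) Z loopFunctor :=
  collapseExchange (by simp)

theorem hasHLP_iff {p : E ⟶ B} : HasHLP p Z ↔ HLP Z p := by
  have key : ∀ {X : PointedTop.{u}} (f : cyl Z ⟶ X),
      cylBottom Z ≫ f = (cylExchange Z).equiv X f ≫ pathEv X 0 := fun _ => rfl
  constructor
  · intro h f G hG
    obtain ⟨g, rfl⟩ := ((cylExchange Z).equiv B).surjective G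
    rw [← key] at hG
    have sq : CommSq f (cylBottom Z) p g := ⟨hG.symm⟩
    have := h.sq_hasLift sq
    refine ⟨(cylExchange Z).equiv E sq.lift, ?_, ?_⟩
    · rw [← key, sq.fac_left]
    · exact congrArg ((cylExchange Z).equiv B) sq.fac_right
  · intro h
    refine ⟨fun {f g} sq => ?_⟩
    obtain ⟨F, hF, hF'⟩ := h f ((cylExchange Z).equiv B g) (by rw [← key, sq.w])
    obtain ⟨F, rfl⟩ := ((cylExchange Z).equiv E).surjective F
    exact ⟨⟨F, by rw [key, hF], ((cylExchange Z).equiv B).injective hF'⟩⟩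

/-! ### The two-point space -/

/-- The two-point discrete space. -/
def twoPoint : PointedTop.{u} where
  carrier := ULift.{u} Bool
  pt := ⟨false⟩

/-- Maps out of the two-point space are points. -/
def twoPointEquiv (X : PointedTop.{u}) : (twoPoint ⟶ X) ≃ X where
  toFun f := f.map ⟨true⟩
  invFun x := ⟨⟨fun b => bif b.down then x else X.pt,
    (continuous_of_discreteTopology (f := fun b : Bool => bif b then x else X.pt)).comp
      continuous_uliftDown⟩, rfl⟩
  left_inv f := hom_ext fun b => by
    rcases b with ⟨_ | _⟩
    · exact f.map_pt.symm
    · rfl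
  right_inv _ := rfl

/-- Pointed maps from `A` are points of the space of pointed maps. -/
def mapSpaceExchange (A : PointedTop.{u}) [LocallyCompactSpace A] :
    Exchange A twoPoint (homFunctor A) where
  iso X := (mapSpaceRelPathIso A ∅).app X
  iso_ev _ _ := rfl
  iso_map _ := rfl
  equiv X := (twoPointEquiv (mapSpace A X)).symm
  equiv_comp _ _ := (twoPointEquiv _).injective rfl

end

/-! ### Relative homotopy lifting -/

section

variable {X Y Z E B : PointedTop.{u}} {C : Set I} {p : E ⟶ B}

/-- A continuous map into the double path space from its uncurried form. -/
def pathPathCurry {T : Type*} [TopologicalSpace T] (a : C(T × (I × I), X)) :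
    C(T, path (path X)) :=
  ⟨fun z => (⟨⟨fun s => (⟨⟨fun t => a (z, (s, t)), by fun_prop⟩, by simp⟩ : relPath ∅ X),
    continuous_relPath_iff.2 (a.continuous.comp (by fun_prop))⟩, by simp⟩ :
      relPath ∅ (relPath ∅ X)),
    continuous_relPath_iff.2 (continuous_relPath_iff.2 (a.continuous.comp
      (by fun_prop : Continuous fun q : (T × I) × I => (q.1.1, (q.1.2, q.2)))))⟩

/-- A pointed map into the double path space from its uncurried form. -/
def toPathPath (a : C(Z × (I × I), X)) (ha : ∀ x, a (Z.pt, x) = X.pt) : Z ⟶ path (path X) where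
  map := pathPathCurry a
  map_pt := relPath_ext fun s => relPath_ext fun t => ha (s, t)

/-- Deformation data for the square: a homotopy which moves every point `x` from time `φ x`
to time `0`. -/
structure SquareDeformation where
  /-- the deformation -/
  H : C((I × I) × I, I × I)
  /-- the time at which a point is at rest -/
  φ : C(I × I, I)
  H_φ : ∀ x, H (x, φ x) = x

theorem SquareDeformation.H_zero (D : SquareDeformation) {x : I × I} (hx : D.φ x = 0) :
    D.H (x, 0) = x := by
  have := D.H_φ x
  rwa [hx] at this

/-- If `p` has the homotopy lifting property for `Z × I²`, then maps on `Z × I²` lift relative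
to the part of the square that does not move under a deformation. -/
theorem exists_square_lift (D : SquareDeformation)
    (h : HLP Z (pathFunctor.map (pathFunctor.map p)))
    (a : C(Z × (I × I), E)) (ha : ∀ x, a (Z.pt, x) = E.pt)
    (G : C(Z × (I × I), B)) (hG : ∀ x, G (Z.pt, x) = B.pt)
    (w : ∀ z x, p.map (a (z, x)) = G (z, D.H (x, 0))) :
    ∃ F : C(Z × (I × I), E), (∀ x, F (Z.pt, x) = E.pt) ∧
      (∀ z x, p.map (F (z, x)) = G (z, x)) ∧ ∀ z x, D.φ x = 0 → F (z, x) = a (z, x) := by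
  let K : Z ⟶ path (path (path B)) :=
    toPath (pathPathCurry ⟨fun r : (Z × I) × (I × I) => G (r.1.1, D.H (r.2, r.1.2)),
      by fun_prop⟩)
      (fun t => relPath_ext fun s => relPath_ext fun s' => hG _)
  obtain ⟨Φ, hΦ, hΦ'⟩ := h (toPathPath a ha) K
    (hom_relPath_ext fun z s => relPath_ext fun t => (w z (s, t)).symm)
  have hΦ0 : ∀ z s t, (((Φ.map z).1 0).1 s).1 t = a (z, (s, t)) := fun z s t =>
    congrArg (fun g : Z ⟶ path (path E) => ((g.map z).1 s).1 t) hΦ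
  have hΦp : ∀ z τ s t, p.map ((((Φ.map z).1 τ).1 s).1 t) = G (z, D.H ((s, t), τ)) :=
    fun z τ s t =>
    congrArg (fun g : Z ⟶ path (path (path B)) => (((g.map z).1 τ).1 s).1 t) hΦ'
  -- Read the lifted homotopy at time `φ x`: it lies over `G (z, H (x, φ x)) = G (z, x)`, and where
  -- `φ x = 0` it is still the initial lift `a`.
  refine ⟨⟨fun q => (((Φ.map q.1).1 (D.φ q.2)).1 q.2.1).1 q.2.2, ?_⟩, ?_, ?_, ?_⟩
  · exact Continuous.relPath_apply (Continuous.relPath_apply (Continuous.relPath_apply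
      (Φ.map.continuous.comp continuous_fst) (by fun_prop)) (by fun_prop)) (by fun_prop)
  · intro x
    change (((Φ.map Z.pt).1 (D.φ x)).1 x.1).1 x.2 = _
    rw [Φ.map_pt]
    rfl
  · intro z x
    exact (hΦp z _ _ _).trans (by rw [Prod.mk.eta, D.H_φ])
  · intro z x hx
    change (((Φ.map z).1 (D.φ x)).1 x.1).1 x.2 = _
    rw [hx, hΦ0]

/-- A deformation of the square that retracts it to the union of the bottom and of the vertical
sides over `C`. -/
structure IsSideDeformation (C : Set I) (D : SquareDeformation) : Prop where
  bottom : ∀ s, D.φ (s, 0) = 0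
  side : ∀ c ∈ C, ∀ t, D.φ (c, t) = 0
  mem : ∀ x, (D.H (x, 0)).2 = 0 ∨ (D.H (x, 0)).1 ∈ C

/-- Lifting of homotopies of paths that are stationary at all times in `C`. -/
theorem exists_lift_rel {D : SquareDeformation} (hD : IsSideDeformation C D)
    (h : HLP Z (pathFunctor.map (pathFunctor.map p)))
    (f : Z ⟶ path E) (G : Z ⟶ path (path B))
    (hG : ∀ z s, ((G.map z).1 0).1 s = p.map ((f.map z).1 s))
    (hC : ∀ z t, ∀ c ∈ C, ((G.map z).1 t).1 c = ((G.map z).1 0).1 c) :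
    ∃ F : Z ⟶ path (path E), (∀ z s, ((F.map z).1 0).1 s = (f.map z).1 s) ∧
      (∀ z t s, p.map (((F.map z).1 t).1 s) = ((G.map z).1 t).1 s) ∧
      ∀ z t, ∀ c ∈ C, ((F.map z).1 t).1 c = (f.map z).1 c := by
  obtain ⟨F, hF, hF', hF''⟩ := exists_square_lift D h
    ⟨fun q => (f.map q.1).1 (D.H (q.2, 0)).1,
      Continuous.relPath_apply (f.map.continuous.comp continuous_fst) (by fun_prop)⟩
    (fun x => relPath_map_pt f _)
    ⟨fun q => ((G.map q.1).1 q.2.2).1 q.2.1,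
      Continuous.relPath_apply (Continuous.relPath_apply
        (G.map.continuous.comp continuous_fst) (by fun_prop)) (by fun_prop)⟩
    (fun x => by
      change ((G.map Z.pt).1 x.2).1 x.1 = _
      rw [G.map_pt]; rfl)
    (fun z x => by
      change p.map ((f.map z).1 (D.H (x, 0)).1) =
        ((G.map z).1 (D.H (x, 0)).2).1 (D.H (x, 0)).1
      rw [← hG]
      -- The retraction lands on the bottom, where `G` is already `p ∘ f`, or over `C`, where `G`
      -- does not depend on time.
      rcases hD.mem x with h | h
      · rw [h]
      · exact (hC z _ _ h).symm)
  have key : ∀ z s t, D.φ (s, t) = 0 → F (z, (s, t)) = (f.map z).1 s := fun z s t hst => by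
    rw [hF'' z _ hst]
    change (f.map z).1 (D.H ((s, t), 0)).1 = _
    rw [D.H_zero hst]
  refine ⟨toPathPath (F.comp ⟨fun q : Z × (I × I) => (q.1, (q.2.2, q.2.1)), by fun_prop⟩)
    (fun x => hF _), ?_, ?_, ?_⟩
  · exact fun z s => key z s 0 (hD.bottom s)
  · exact fun z t s => hF' z (s, t)
  · exact fun z t c hc => key z c t (hD.side c hc t)

/-- A homotopy of paths trivial on `C` is stationary over `C`, so it has a lift that is stationary
there too; this lift stays at the base point over `C`. -/
theorem HLP.map_relPath {D : SquareDeformation} (hD : IsSideDeformation C D)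
    (h : HLP Z (pathFunctor.map (pathFunctor.map p))) : HLP Z ((relPathFunctor C).map p) := by
  intro f G hG
  have hG' : ∀ z s, ((G.map z).1 0).1 s = p.map ((f.map z).1 s) := fun z s =>
    congrArg (fun g : Z ⟶ (relPathFunctor C).obj B => (g.map z).1 s) hG
  obtain ⟨F, hF, hF', hF''⟩ := exists_lift_rel hD h
    (toPath (ofRel f) (fun t => relPath_map_pt f t))
    (toPathPath ⟨fun q => ((G.map q.1).1 q.2.1).1 q.2.2,
      Continuous.relPath_apply (Continuous.relPath_apply
        (G.map.continuous.comp continuous_fst) (by fun_prop)) (by fun_prop)⟩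
      (fun x => by
        change ((G.map Z.pt).1 x.1).1 x.2 = _
        rw [G.map_pt]; rfl))
    hG'
    (fun z t c hc => (((G.map z).1 t).2 c hc).trans (((G.map z).1 0).2 c hc).symm)
  refine ⟨toPath ⟨fun q => (⟨((F.map q.1).1 q.2).1, fun c hc =>
      (hF'' q.1 q.2 c hc).trans ((f.map q.1).2 c hc)⟩ : relPath C E),
      continuous_relPath_iff.2 (Continuous.relPath_apply (Continuous.relPath_apply
        (F.map.continuous.comp (continuous_fst.comp continuous_fst))
          (continuous_snd.comp continuous_fst)) continuous_snd)⟩ (fun t => ?_), ?_, ?_⟩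
  · refine relPath_ext fun s => ?_
    change ((F.map Z.pt).1 t).1 s = _
    rw [F.map_pt]; rfl
  · exact hom_relPath_ext fun z s => hF z s
  · exact hom_relPath_ext fun z t => relPath_ext fun s => hF' z t s

/-! ### The diagonal and the radial deformation of the square. -/

theorem sub_add_min_mem {a m τ : ℝ} (ha : a ∈ I) (hm : m ≤ a) (hm0 : 0 ≤ m) (hτ : 0 ≤ τ) :
    a - m + min τ m ∈ I :=
  ⟨by linarith [le_min hτ hm0], by linarith [min_le_right τ m, ha.2]⟩

/-- The deformation of the square to the union of the left and the bottom side. -/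
def cornerDeformation : SquareDeformation where
  -- Points move along the direction `(1, 1)`. Subtracting `min s t` from both coordinates reaches
  -- the left or bottom side, and the point is back in place from time `min s t` on.
  H := ⟨fun q => (⟨q.1.1 - min (q.1.1 : ℝ) q.1.2 + min (q.2 : ℝ) (min (q.1.1 : ℝ) q.1.2),
      sub_add_min_mem q.1.1.2 (min_le_left _ _) (le_min q.1.1.2.1 q.1.2.2.1) q.2.2.1⟩,
    ⟨q.1.2 - min (q.1.1 : ℝ) q.1.2 + min (q.2 : ℝ) (min (q.1.1 : ℝ) q.1.2),
      sub_add_min_mem q.1.2.2 (min_le_right _ _) (le_min q.1.1.2.1 q.1.2.2.1) q.2.2.1⟩),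
    by fun_prop⟩
  φ := ⟨fun x => min x.1 x.2, by fun_prop⟩
  H_φ := by
    rintro ⟨s, t⟩
    ext <;> simp

theorem cornerDeformation_H_zero (s t : I) :
    ((cornerDeformation.H ((s, t), 0)).1 : ℝ) = s - min (s : ℝ) t ∧
      ((cornerDeformation.H ((s, t), 0)).2 : ℝ) = t - min (s : ℝ) t := by
  have : min (0 : ℝ) (min s t) = 0 := min_eq_left (le_min s.2.1 t.2.1)
  constructor <;> simp [cornerDeformation, this]

theorem isSideDeformation_corner : IsSideDeformation {0} cornerDeformation where
  bottom s := min_eq_right s.2.1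
  side := by
    rintro c rfl t
    exact min_eq_left t.2.1
  mem := by
    rintro ⟨s, t⟩
    obtain ⟨h1, h2⟩ := cornerDeformation_H_zero s t
    rcases le_total (s : ℝ) t with h | h
    · right
      rw [min_eq_left h, sub_self] at h1
      exact Subtype.ext h1
    · left
      rw [min_eq_right h, sub_self] at h2
      exact Subtype.ext h2

/-- The scale in the radial deformation of the square from a point above it. -/
noncomputable def radialScale (s t : I) : ℝ := max ((2 - t) / 2) |2 * (s : ℝ) - 1|

theorem radialScale_pos (s t : I) : 1 / 2 ≤ radialScale s t :=
  le_max_of_le_left (by linarith [t.2.2])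

theorem radialScale_le (s t : I) : radialScale s t ≤ 1 :=
  max_le (by linarith [t.2.1]) (abs_le.2 ⟨by linarith [s.2.1], by linarith [s.2.2]⟩)

/-- The centre of projection is `(1/2, 2)`, and the vector from it to `(s, t)` is divided by `ν`.
The bottom is reached at `ν = (2 - t) / 2` and a vertical side at `ν = |2 * s - 1|`; the larger of
the two is met first as `ν` decreases from `1`, so the image stays in the square. -/
theorem radial_mem {s t : I} {ν : ℝ} (h : radialScale s t ≤ ν) (h1 : ν ≤ 1) :
    ((2 * (s : ℝ) - 1) / ν + 1) / 2 ∈ I ∧ 2 - (2 - (t : ℝ)) / ν ∈ I := by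
  have hν : 0 < ν := by linarith [radialScale_pos s t]
  obtain ⟨ha, hb⟩ := max_le_iff.1 h
  obtain ⟨hb, hb'⟩ := abs_le.1 hb
  have e1 : (2 * (s : ℝ) - 1) / ν ≤ 1 := (div_le_one hν).2 hb'
  have e2 : -1 ≤ (2 * (s : ℝ) - 1) / ν := (le_div_iff₀ hν).2 (by linarith)
  have e3 : (2 - (t : ℝ)) / ν ≤ 2 := (div_le_iff₀ hν).2 (by linarith)
  have e4 : 1 ≤ (2 - (t : ℝ)) / ν := (le_div_iff₀ hν).2 (by linarith [t.2.2])
  exact ⟨⟨by linarith, by linarith⟩, ⟨by linarith, by linarith⟩⟩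

theorem continuous_radialScale : Continuous fun x : I × I => radialScale x.1 x.2 := by
  unfold radialScale
  fun_prop

/-- The radial deformation of the square from a point above it. -/
noncomputable def radialDeformation : SquareDeformation where
  H := ⟨fun q =>
    (⟨((2 * (q.1.1 : ℝ) - 1) / min 1 (radialScale q.1.1 q.1.2 + q.2) + 1) / 2,
      (radial_mem (le_min (radialScale_le _ _) (by linarith [q.2.2.1])) (min_le_left _ _)).1⟩,
    ⟨2 - (2 - (q.1.2 : ℝ)) / min 1 (radialScale q.1.1 q.1.2 + q.2),
      (radial_mem (le_min (radialScale_le _ _) (by linarith [q.2.2.1])) (min_le_left _ _)).2⟩),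
    by
      have h : Continuous fun q : (I × I) × I => min 1 (radialScale q.1.1 q.1.2 + q.2) :=
        continuous_const.min
          ((continuous_radialScale.comp continuous_fst).add (by fun_prop))
      have h0 : ∀ q : (I × I) × I, min 1 (radialScale q.1.1 q.1.2 + q.2) ≠ 0 := fun q =>
        (lt_min one_pos (by linarith [radialScale_pos q.1.1 q.1.2, q.2.2.1])).ne'
      exact ((((by fun_prop : Continuous fun q : (I × I) × I => 2 * (q.1.1 : ℝ) - 1).div h
        h0).add continuous_const).div_const 2).subtype_mk _ |>.prodMk
        ((continuous_const.sub ((by fun_prop : Continuous fun q : (I × I) × I =>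
          2 - (q.1.2 : ℝ)).div h h0)).subtype_mk _)⟩
  φ := ⟨fun x => ⟨1 - radialScale x.1 x.2, by linarith [radialScale_le x.1 x.2],
    by linarith [radialScale_pos x.1 x.2]⟩,
    (continuous_const.sub continuous_radialScale).subtype_mk _⟩
  H_φ := by
    rintro ⟨s, t⟩
    ext <;> simp

theorem isSideDeformation_radial : IsSideDeformation {0, 1} radialDeformation where
  bottom s := by
    have : radialScale s 0 = 1 :=
      le_antisymm (radialScale_le _ _) (le_max_of_le_left (by norm_num))
    exact Subtype.ext (by simp [radialDeformation, this])
  side := by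
    rintro c hc t
    have : radialScale c t = 1 := by
      refine le_antisymm (radialScale_le _ _) (le_max_of_le_right ?_)
      rcases hc with rfl | rfl <;> norm_num
    exact Subtype.ext (by simp [radialDeformation, this])
  mem := by
    rintro ⟨s, t⟩
    have hpos : 0 < radialScale s t := by linarith [radialScale_pos s t]
    have hmin : min 1 (radialScale s t) = radialScale s t := min_eq_right (radialScale_le _ _)
    rcases max_choice ((2 - (t : ℝ)) / 2) |2 * (s : ℝ) - 1| with h | h
    · left
      apply Subtype.ext
      simp only [radialDeformation, ContinuousMap.coe_mk, Set.Icc.coe_zero, add_zero, hmin]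
      change radialScale s t = _ at h
      rw [h] at hpos ⊢
      have : 2 - (t : ℝ) ≠ 0 := by intro h0; simp [h0] at hpos
      field_simp
      ring
    · right
      change radialScale s t = _ at h
      rcases abs_choice (2 * (s : ℝ) - 1) with h' | h'
      · right
        apply Subtype.ext
        simp only [radialDeformation, ContinuousMap.coe_mk, Set.Icc.coe_zero, add_zero, hmin]
        rw [h, h'] at hpos ⊢
        rw [div_self hpos.ne']
        norm_num
      · left
        apply Subtype.ext
        simp only [radialDeformation, ContinuousMap.coe_mk, Set.Icc.coe_zero, add_zero, hmin]
        rw [h, h'] at hpos ⊢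
        have : 2 * (s : ℝ) - 1 ≠ 0 := by intro h0; simp [h0] at hpos
        rw [div_neg, div_self this]
        norm_num

end

/-! ### Fibrations and cubes -/

section

variable {X Y Z E B A : PointedTop.{u}} {C : Set I} {p : E ⟶ B}

/-- The homotopy lifting property for all cubes `Iᵏ A`. -/
def CubeHLP (A : PointedTop.{u}) {E B : PointedTop.{u}} (p : E ⟶ B) : Prop :=
  ∀ k, HLP (iterCyl A k) p

theorem CubeHLP.map_path (h : CubeHLP A p) : CubeHLP A (pathFunctor.map p) :=
  fun k => ((cylExchange _).hlp_iff p).1 (h (k + 1))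

/-- Relative lifting over the square costs two extra cylinder coordinates, which are available
because the hypothesis covers cubes of all dimensions. -/
theorem CubeHLP.map_relPath {D : SquareDeformation} (hD : IsSideDeformation C D)
    (h : CubeHLP A p) : CubeHLP A ((relPathFunctor C).map p) :=
  fun k => HLP.map_relPath hD (h.map_path.map_path k)

theorem CubeHLP.map_loop (h : CubeHLP A p) : CubeHLP A (loopFunctor.map p) :=
  h.map_relPath isSideDeformation_radial

theorem CubeHLP.hlp_iterSusp (h : CubeHLP A p) (n : ℕ) : HLP (iterSusp A n) p := by
  induction n generalizing E B with
  | zero => exact h 0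
  | succ n ih => exact ((suspExchange _).hlp_iff p).2 (ih h.map_loop)

/-- The cone condition is redundant: it transposes to lifting from `ΣⁿA` against the map of based
path spaces, which inherits the cube condition through the corner deformation; the suspensions are
then removed by passing to loops. -/
theorem fib_iff : fib A p ↔ CubeHLP A p := by
  constructor
  · rintro ⟨h, -, h'⟩ (_ | k)
    · exact hasHLP_iff.1 h
    · exact hasHLP_iff.1 (h' k)
  · intro h
    exact ⟨hasHLP_iff.2 (h 0),
      fun n => hasHLP_iff.2 (((coneExchange _).hlp_iff p).2
        ((h.map_relPath isSideDeformation_corner).hlp_iterSusp n)),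
      fun n => hasHLP_iff.2 (h (n + 1))⟩

theorem fib.map_loop (h : fib A p) : fib A (loopFunctor.map p) :=
  fib_iff.2 (fib_iff.1 h).map_loop

/-! ### Weak equivalences -/

theorem Homotopic.refl (f : X ⟶ Y) : Homotopic f f := (homotopicSetoid X Y).refl f

theorem Homotopic.symm {f g : X ⟶ Y} (h : Homotopic f g) : Homotopic g f :=
  (homotopicSetoid X Y).symm h

theorem Homotopic.trans {f g h : X ⟶ Y} (h₁ : Homotopic f g) (h₂ : Homotopic g h) :
    Homotopic f h :=
  (homotopicSetoid X Y).trans h₁ h₂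

theorem Homotopic.comp_left {f g : X ⟶ Y} (h : Homotopic f g) (k : Z ⟶ X) :
    Homotopic (k ≫ f) (k ≫ g) := by
  obtain ⟨G, rfl, rfl⟩ := homotopic_iff.1 h
  exact homotopic_iff.2 ⟨k ≫ G, rfl, rfl⟩

/-- Looping shifts the degree by one. -/
theorem weq.map_loop (h : weq A p) : weq A (loopFunctor.map p) :=
  weq_iff.2 fun n => ((suspExchange _).bij_iff p).1 (weq_iff.1 h (n + 1))

theorem weq_of_homotopy_equiv {f : X ⟶ Y} (r : Y ⟶ X) (h : Homotopic (f ≫ r) (𝟙 X))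
    (h' : Homotopic (r ≫ f) (𝟙 Y)) : weq A f := by
  refine weq_iff.2 fun n => ⟨fun a b hab => ?_, fun b => ⟨b ≫ r, ?_⟩⟩
  · have := hab.comp_right r
    simp only [Category.assoc] at this
    have ha := h.comp_left a
    have hb := h.comp_left b
    rw [Category.comp_id] at ha hb
    exact (ha.symm.trans this).trans hb
  · have := h'.comp_left b
    rwa [Category.comp_id, ← Category.assoc] at this

theorem homotopySetMap_comp (A : PointedTop.{u}) (n : ℕ) (f : X ⟶ Y) (g : Y ⟶ Z) :
    homotopySetMap A n (f ≫ g) = homotopySetMap A n g ∘ homotopySetMap A n f := by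
  funext x
  obtain ⟨x, rfl⟩ := Quotient.exists_rep x
  rfl

instance (A : PointedTop.{u}) : (weq A).HasTwoOutOfThreeProperty where
  comp_mem f g hf hg n := by
    rw [homotopySetMap_comp]
    exact (hg n).comp (hf n)
  of_postcomp f g hg hfg n := by
    have := hfg n
    rw [homotopySetMap_comp] at this
    exact (Function.Bijective.of_comp_iff' (hg n) _).1 this
  of_precomp f g hf hfg n := by
    have := hfg n
    rw [homotopySetMap_comp] at this
    exact (Function.Bijective.of_comp_iff _ (hf n)).1 this

/-! ### The mapping path space -/

/-- The inclusion of constant paths. -/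
def constPath (X : PointedTop.{u}) : X ⟶ path X :=
  toPath ⟨fun q => q.1, continuous_fst⟩ fun _ => rfl

/-- The mapping path space of `f`: pairs of a point `x` and a path that starts at `f x`. -/
def pathFiber (f : X ⟶ Y) : PointedTop.{u} where
  carrier := {q : X × relPath ∅ Y // q.2.1 0 = f.map q.1}
  pt := ⟨(X.pt, (relPath ∅ Y).pt), f.map_pt.symm⟩

/-- The projection to the point. -/
def pathFiberFst (f : X ⟶ Y) : pathFiber f ⟶ X where
  map := ⟨fun q => q.1.1, continuous_fst.comp continuous_subtype_val⟩
  map_pt := rfl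

/-- The projection to the path. -/
def pathFiberSnd (f : X ⟶ Y) : pathFiber f ⟶ path Y where
  map := ⟨fun q => q.1.2, continuous_snd.comp continuous_subtype_val⟩
  map_pt := rfl

/-- The universal property of the mapping path space. -/
def pathFiberLift {f : X ⟶ Y} (a : Z ⟶ X) (b : Z ⟶ path Y) (h : b ≫ pathEv Y 0 = a ≫ f) :
    Z ⟶ pathFiber f where
  map := ⟨fun z => ⟨(a.map z, b.map z), congrArg (fun g : Z ⟶ Y => g.map z) h⟩,
    (a.map.continuous.prodMk b.map.continuous).subtype_mk _⟩
  map_pt := Subtype.ext (Prod.ext a.map_pt b.map_pt)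

theorem pathFiber_hom_ext {f : X ⟶ Y} {g h : Z ⟶ pathFiber f}
    (h₁ : g ≫ pathFiberFst f = h ≫ pathFiberFst f)
    (h₂ : g ≫ pathFiberSnd f = h ≫ pathFiberSnd f) : g = h :=
  hom_ext fun z => Subtype.ext (Prod.ext (congrArg (fun k : Z ⟶ X => k.map z) h₁)
    (congrArg (fun k : Z ⟶ path Y => k.map z) h₂))

/-- The inclusion of constant paths into the mapping path space. -/
def pathFiberIncl (f : X ⟶ Y) : X ⟶ pathFiber f :=
  pathFiberLift (𝟙 X) (f ≫ constPath Y) rfl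

/-- The end point of the path. -/
def pathFiberEnd (f : X ⟶ Y) : pathFiber f ⟶ Y :=
  pathFiberSnd f ≫ pathEv Y 1

/-- The contraction of paths to their starting points. -/
def pathContraction (X : PointedTop.{u}) : path X ⟶ path (path X) :=
  toPathPath ⟨fun q => q.1.1 (q.2.1 * q.2.2), Continuous.relPath_apply continuous_fst
    (by fun_prop)⟩ (fun _ => rfl)

theorem weq_constPath (X : PointedTop.{u}) : weq A (constPath X) :=
  weq_of_homotopy_equiv (pathEv X 0) (.refl _)
    (homotopic_iff.2 ⟨pathContraction X,
      hom_relPath_ext fun γ s => congrArg γ.1 (zero_mul s),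
      hom_relPath_ext fun γ s => congrArg γ.1 (one_mul s)⟩)

/-- The contraction of the mapping path space to the constant paths. -/
def pathFiberContraction (f : X ⟶ Y) : pathFiber f ⟶ path (pathFiber f) :=
  toPath (Z := pathFiber f) (X := pathFiber f)
    ⟨fun q : pathFiber f × I => ⟨(q.1.1.1, ((pathContraction Y).map q.1.1.2).1 q.2),
      (congrArg q.1.1.2.1 (mul_zero q.2)).trans q.1.2⟩,
      (((pathFiberFst f).map.continuous.comp continuous_fst).prodMk
        (Continuous.relPath_apply ((pathFiberSnd f ≫ pathContraction Y).map.continuous.comp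
          continuous_fst) continuous_snd)).subtype_mk _⟩
    fun _ => rfl

theorem weq_pathFiberIncl (f : X ⟶ Y) : weq A (pathFiberIncl f) :=
  weq_of_homotopy_equiv (pathFiberFst f) (.refl _) (homotopic_iff.2
    ⟨pathFiberContraction f,
      pathFiber_hom_ext rfl (hom_relPath_ext fun q s =>
        (congrArg q.1.2.1 (zero_mul s)).trans q.2),
      pathFiber_hom_ext rfl (hom_relPath_ext fun q s => congrArg q.1.2.1 (one_mul s))⟩)

/-- A motion of the end point is lifted by prolonging the path along that motion, with its starting
point fixed. No hypothesis on `Z` or `f` enters. -/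
theorem hlp_pathFiberEnd (f : X ⟶ Y) : HLP Z (pathFiberEnd f) := by
  intro h G hG
  have hG' : ∀ z, (G.map z).1 0 = (h.map z).1.2.1 1 := fun z =>
    congrArg (fun g : Z ⟶ Y => g.map z) hG
  have hproj0 : ∀ s : I, Set.projIcc (0 : ℝ) 1 zero_le_one s = s := fun s =>
    Set.projIcc_val zero_le_one s
  -- At homotopy time `t` the prolonged path has length `1 + t`; path time `s` is rescaled to `s *
  -- (1 + t)`. The projections to `[0, 1]` make each branch globally defined.
  let β : (Z × I) × I → Y := fun q => if (q.2 : ℝ) * (1 + q.1.2) ≤ 1 then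
      (h.map q.1.1).1.2.1 (Set.projIcc 0 1 zero_le_one ((q.2 : ℝ) * (1 + q.1.2)))
    else (G.map q.1.1).1 (Set.projIcc 0 1 zero_le_one ((q.2 : ℝ) * (1 + q.1.2) - 1))
  have hβ : Continuous β := by
    refine Continuous.if_le ?_ ?_ (by fun_prop) (by fun_prop) ?_
    · exact Continuous.relPath_apply ((h ≫ pathFiberSnd f).map.continuous.comp
        (continuous_fst.comp continuous_fst)) (continuous_projIcc.comp (by fun_prop))
    · exact Continuous.relPath_apply (G.map.continuous.comp
        (continuous_fst.comp continuous_fst)) (continuous_projIcc.comp (by fun_prop))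
    · intro q hq
      rw [hq, sub_self, Set.projIcc_right, Set.projIcc_left]
      exact (hG' q.1.1).symm
  have hβ0 : ∀ z t, β ((z, t), 0) = f.map (h.map z).1.1 := fun z t => by
    simp only [β, Set.Icc.coe_zero, zero_mul, zero_le_one, if_true, Set.projIcc_left]
    exact (h.map z).2
  refine ⟨toPath ⟨fun q => ⟨((h.map q.1).1.1, ⟨⟨fun s => β (q, s), by fun_prop⟩, by simp⟩),
    hβ0 _ _⟩, ?_⟩ fun t => ?_, pathFiber_hom_ext rfl ?_, ?_⟩
  · exact (((h ≫ pathFiberFst f).map.continuous.comp continuous_fst).prodMk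
      (continuous_relPath_iff.2 hβ)).subtype_mk _
  · refine Subtype.ext (Prod.ext (congrArg (fun q => q.1.1) h.map_pt) (relPath_ext fun s => ?_))
    change β ((Z.pt, t), s) = _
    simp only [β, h.map_pt, G.map_pt]
    split_ifs <;> rfl
  · refine hom_relPath_ext fun z s => ?_
    change β ((z, 0), s) = (h.map z).1.2.1 s
    simp [β, s.2.2, hproj0]
  · refine hom_relPath_ext fun z t => ?_
    change β ((z, t), 1) = (G.map z).1 t
    by_cases ht : (t : ℝ) ≤ 0
    · obtain rfl : t = 0 := Subtype.ext (le_antisymm ht t.2.1)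
      simpa [β] using (hG' z).symm
    · have : ¬ (1 : ℝ) * (1 + t) ≤ 1 := by linarith
      simp only [β, Set.Icc.coe_one, this, if_false]
      rw [one_mul, add_sub_cancel_left, hproj0]

theorem fib_pathFiberEnd (f : X ⟶ Y) : fib A (pathFiberEnd f) :=
  fib_iff.2 fun _ => hlp_pathFiberEnd f

/-- The comparison map from the path space to the mapping path space. -/
def pathFiberComparison (p : E ⟶ B) : path E ⟶ pathFiber p :=
  pathFiberLift (pathEv E 0) (pathFunctor.map p) rfl

/-- On constant paths this map is the inclusion `pathFiberIncl p`; both inclusions are homotopy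
equivalences, so two-out-of-three applies. -/
theorem weq_pathFiberComparison (p : E ⟶ B) : weq A (pathFiberComparison p) :=
  (weq A).of_precomp (W' := weq A) (constPath E) _ (weq_constPath E) (weq_pathFiberIncl p)

/-- A lifting problem here prescribes a map of the square to `B` together with a lift to `E` over
the bottom (the initial paths) and the left side (the moving starting points). The corner
deformation extends such a lift to the whole square. -/
theorem HLP.comparison (h : HLP Z (pathFunctor.map (pathFunctor.map p))) :
    HLP Z (pathFiberComparison p) := by
  intro f G hG
  have hG' : ∀ z, ((G.map z).1 0).1 = ((f.map z).1 0, (pathFunctor.map p).map (f.map z)) :=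
    fun z => congrArg (fun g : Z ⟶ pathFiber p => (g.map z).1) hG
  have hG1 : ∀ z, ((G.map z).1 0).1.1 = (f.map z).1 0 := fun z => congrArg Prod.fst (hG' z)
  have hG2 : ∀ z s, ((G.map z).1 0).1.2.1 s = p.map ((f.map z).1 s) := fun z s =>
    congrArg (fun q : E × relPath ∅ B => q.2.1 s) (hG' z)
  -- The initial lift is the prescribed one composed with the retraction to the two sides: below the
  -- diagonal it lands on the bottom, above it on the left side.
  let a : Z × (I × I) → E := fun q => if q.2.2 ≤ q.2.1 then
      (f.map q.1).1 (cornerDeformation.H (q.2, 0)).1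
    else ((G.map q.1).1 (cornerDeformation.H (q.2, 0)).2).1.1
  have hH1 : ∀ s t : I, t ≤ s → (cornerDeformation.H ((s, t), 0)).2 = 0 := fun s t hst =>
    Subtype.ext (by rw [(cornerDeformation_H_zero s t).2, min_eq_right (show (t : ℝ) ≤ s from hst)]; simp)
  have hH2 : ∀ s t : I, s ≤ t → (cornerDeformation.H ((s, t), 0)).1 = 0 := fun s t hst =>
    Subtype.ext (by rw [(cornerDeformation_H_zero s t).1, min_eq_left (show (s : ℝ) ≤ t from hst)]; simp)
  have ha : Continuous a := by
    refine Continuous.if_le ?_ ?_ (by fun_prop) (by fun_prop) ?_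
    · exact Continuous.relPath_apply (f.map.continuous.comp continuous_fst) (by fun_prop)
    · exact (pathFiberFst p).map.continuous.comp
        (Continuous.relPath_apply (G.map.continuous.comp continuous_fst) (by fun_prop))
    · rintro ⟨z, s, t⟩ (hq : t = s)
      dsimp only
      rw [hH1 s t hq.le, hH2 s t hq.ge, hG1]
  have hGc : Continuous fun q : Z × (I × I) => ((G.map q.1).1 q.2.2).1.2.1 q.2.1 :=
    Continuous.relPath_apply ((pathFiberSnd p).map.continuous.comp
      (Continuous.relPath_apply (G.map.continuous.comp continuous_fst) (by fun_prop)))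
      (by fun_prop)
  obtain ⟨F, hF, hF', hF''⟩ := exists_square_lift cornerDeformation h ⟨a, ha⟩
    (fun x => by
      change a (Z.pt, x) = _
      simp only [a, f.map_pt, G.map_pt]
      split_ifs <;> rfl)
    ⟨_, hGc⟩ (fun x => by
      change ((G.map Z.pt).1 x.2).1.2.1 x.1 = _
      rw [G.map_pt]; rfl)
    (by
      rintro z ⟨s, t⟩
      change p.map (a (z, (s, t))) = ((G.map z).1 (cornerDeformation.H ((s, t), 0)).2).1.2.1
        (cornerDeformation.H ((s, t), 0)).1
      by_cases hst : t ≤ s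
      · simp only [a, hst, if_true]
        rw [hH1 s t hst, hG2]
      · simp only [a, hst, if_false]
        rw [hH2 s t (le_of_not_ge hst)]
        exact ((G.map z).1 _).2.symm)
  have key1 : ∀ z s, F (z, (s, 0)) = (f.map z).1 s := fun z s => by
    have h0 : cornerDeformation.φ (s, 0) = 0 := min_eq_right s.2.1
    rw [hF'' z _ h0]
    have : (0 : I) ≤ s := s.2.1
    simp only [ContinuousMap.coe_mk, a, this, if_true]
    rw [cornerDeformation.H_zero h0]
  have key2 : ∀ z t, F (z, (0, t)) = ((G.map z).1 t).1.1 := fun z t => by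
    have h0 : cornerDeformation.φ (0, t) = 0 := min_eq_left t.2.1
    by_cases ht : t ≤ 0
    · obtain rfl : t = 0 := le_antisymm ht t.2.1
      rw [key1, hG1]
    · rw [hF'' z _ h0]
      simp only [ContinuousMap.coe_mk, a, ht, if_false]
      rw [cornerDeformation.H_zero h0]
  refine ⟨toPathPath (F.comp ⟨fun q : Z × (I × I) => (q.1, (q.2.2, q.2.1)), by fun_prop⟩)
    (fun x => hF _), hom_relPath_ext fun z s => key1 z s, hom_relPath_ext fun z t =>
    Subtype.ext (Prod.ext (key2 z t) (relPath_ext fun s => hF' z (s, t)))⟩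

theorem fib_pathFiberComparison (h : fib A p) : fib A (pathFiberComparison p) :=
  fib_iff.2 fun k => ((fib_iff.1 h).map_path.map_path k).comparison

/-! ### Trivial cofibrations lift against fibrations -/

theorem cof_hasLiftingProperty {i : X ⟶ Y} (hi : cof A i) (hp : fib A p) (hw : weq A p) :
    HasLiftingProperty i p :=
  hi p ⟨hp, hw⟩

/-- By two-out-of-three the end point map of the mapping path space of `i` is a trivial fibration.
Lifting against it makes `X` a deformation retract of `Y`, by a homotopy `H` from `i ∘ ρ` to the
identity that is fixed on `X`. Given a square `(f, g)`, one then lifts the path `g ∘ H` starting at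
`f ∘ ρ` and takes its end point; lifting against the trivial fibration `pathFiberComparison p` does
this with constant paths prescribed on `X`. -/
theorem trivialCof_hasLiftingProperty {i : X ⟶ Y} (hi : cof A i) (hw : weq A i)
    (hp : fib A p) : HasLiftingProperty i p := by
  have hend : weq A (pathFiberEnd i) :=
    (weq A).of_precomp (W' := weq A) (pathFiberIncl i) _ (weq_pathFiberIncl i) hw
  have sq : CommSq (pathFiberIncl i) i (pathFiberEnd i) (𝟙 Y) := ⟨by rw [Category.comp_id]; rfl⟩
  have := cof_hasLiftingProperty hi (fib_pathFiberEnd i) hend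
  let ρ : Y ⟶ X := sq.lift ≫ pathFiberFst i
  let H : Y ⟶ path Y := sq.lift ≫ pathFiberSnd i
  have hρ : i ≫ ρ = 𝟙 X := by
    rw [← Category.assoc, sq.fac_left]; rfl
  have hH : i ≫ H = i ≫ constPath Y := by
    rw [← Category.assoc, sq.fac_left]; rfl
  have hH0 : H ≫ pathEv Y 0 = ρ ≫ i := hom_ext fun y => (sq.lift.map y).2
  have hH1 : H ≫ pathEv Y 1 = 𝟙 Y := (Category.assoc _ _ _).trans sq.fac_right
  refine ⟨fun {f g} sq' => ?_⟩
  have hw0 : (H ≫ pathFunctor.map g) ≫ pathEv B 0 = (ρ ≫ f) ≫ p := by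
    rw [Category.assoc, pathFunctor_map_ev, ← Category.assoc, hH0, Category.assoc ρ i g,
      ← sq'.w, Category.assoc ρ f p]
  have sq'' : CommSq (f ≫ constPath E) i (pathFiberComparison p)
      (pathFiberLift (ρ ≫ f) (H ≫ pathFunctor.map g) hw0) := ⟨by
    refine pathFiber_hom_ext ?_ ?_
    · change f = i ≫ ρ ≫ f
      rw [← Category.assoc, hρ, Category.id_comp]
    · change f ≫ constPath E ≫ pathFunctor.map p = i ≫ H ≫ pathFunctor.map g
      rw [← Category.assoc, ← Category.assoc, hH]
      change (f ≫ p) ≫ constPath B = (i ≫ g) ≫ constPath B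
      rw [sq'.w]⟩
  have := cof_hasLiftingProperty hi (fib_pathFiberComparison hp) (weq_pathFiberComparison p)
  refine ⟨⟨sq''.lift ≫ pathEv E 1, ?_, ?_⟩⟩
  · rw [← Category.assoc, sq''.fac_left]; rfl
  · change sq''.lift ≫ pathFiberComparison p ≫ pathFiberSnd p ≫ pathEv B 1 = g
    rw [← Category.assoc, sq''.fac_right]
    change H ≫ pathFunctor.map g ≫ pathEv B 1 = g
    rw [pathFunctor_map_ev, ← Category.assoc, hH1, Category.id_comp]

end

end PointedTop

namespace PointedTop

open Limits

/-! ### Limits and colimits of pointed spaces -/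

section

universe w

variable {J : Type u} [Category.{w} J] (F : J ⥤ PointedTop.{u})

/-- The relation on the disjoint union of a diagram and a point whose quotient is the colimit. -/
inductive ColimitRel : ((Σ j, F.obj j) ⊕ PUnit.{u + 1}) → ((Σ j, F.obj j) ⊕ PUnit.{u + 1}) → Prop
  | map {j k : J} (f : j ⟶ k) (x : F.obj j) :
      ColimitRel (Sum.inl ⟨j, x⟩) (Sum.inl ⟨k, (F.map f).map x⟩)
  | pt (j : J) : ColimitRel (Sum.inl ⟨j, (F.obj j).pt⟩) (Sum.inr ⟨⟩)

/-- The colimit cocone of a diagram of pointed spaces. -/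
def colimitCocone : Cocone F where
  pt :=
    { carrier := Quot (ColimitRel F)
      pt := Quot.mk _ (Sum.inr ⟨⟩) }
  ι :=
    { app := fun j =>
        { map := ⟨fun x => Quot.mk _ (Sum.inl ⟨j, x⟩), continuous_quot_mk.comp
            (continuous_inl.comp continuous_sigmaMk)⟩
          map_pt := Quot.sound (ColimitRel.pt j) }
      naturality := fun _ _ f => hom_ext fun x => (Quot.sound (ColimitRel.map f x)).symm }

/-- The colimit cocone is a colimit. -/
def isColimitColimitCocone : IsColimit (colimitCocone F) where
  desc s :=
    { map := ⟨Quot.lift (Sum.elim (fun x => (s.ι.app x.1).map x.2) (fun _ => s.pt.pt)) (by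
          rintro _ _ (⟨f, x⟩ | ⟨j⟩)
          · exact (congrArg (fun g : F.obj _ ⟶ s.pt => g.map x) (s.w f)).symm
          · exact (s.ι.app j).map_pt),
        continuous_quot_lift _ (continuous_sum_dom.2
          ⟨continuous_sigma fun j => (s.ι.app j).map.continuous, continuous_const⟩)⟩
      map_pt := rfl }
  fac _ _ := rfl
  uniq s m hm := hom_ext fun x => by
    obtain ⟨⟨j, x⟩ | ⟨⟩, rfl⟩ := Quot.exists_rep x
    · exact congrArg (fun g : F.obj j ⟶ s.pt => g.map x) (hm j)
    · exact m.map_pt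

instance : HasColimitsOfSize.{w, u} PointedTop.{u} where
  has_colimits_of_shape _ _ := ⟨fun F => ⟨⟨⟨colimitCocone F, isColimitColimitCocone F⟩⟩⟩⟩

/-- The limit cone of a diagram of pointed spaces. -/
def limitCone : Cone F where
  pt :=
    { carrier := {x : ∀ j, F.obj j // ∀ ⦃j k⦄ (f : j ⟶ k), (F.map f).map (x j) = x k}
      pt := ⟨fun j => (F.obj j).pt, fun _ _ f => (F.map f).map_pt⟩ }
  π :=
    { app := fun j =>
        { map := ⟨fun x => x.1 j, (continuous_apply j).comp continuous_subtype_val⟩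
          map_pt := rfl }
      naturality := fun _ _ f => hom_ext fun x => (x.2 f).symm }

/-- The limit cone is a limit. -/
def isLimitLimitCone : IsLimit (limitCone F) where
  lift s :=
    { map := ⟨fun x => ⟨fun j => (s.π.app j).map x, fun _ _ f =>
          congrArg (fun g : s.pt ⟶ F.obj _ => g.map x) (s.w f)⟩,
        (continuous_pi fun j => (s.π.app j).map.continuous).subtype_mk _⟩
      map_pt := Subtype.ext (funext fun j => (s.π.app j).map_pt) }
  fac _ _ := rfl
  uniq _ _ hm := hom_ext fun x => Subtype.ext (funext fun j =>
    congrArg (fun g : _ ⟶ F.obj j => g.map x) (hm j))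

instance : HasLimitsOfSize.{w, u} PointedTop.{u} where
  has_limits_of_shape _ _ := ⟨fun F => ⟨⟨⟨limitCone F, isLimitLimitCone F⟩⟩⟩⟩

end

/-! ### Embeddings as a class defined by a left lifting property -/

section

variable {X Y Z : PointedTop.{u}}

/-- The one-point space. -/
def onePoint : PointedTop.{u} where
  carrier := PUnit.{u + 1}
  pt := ⟨⟩

/-- The indiscrete space on two points. -/
def indiscrete : PointedTop.{u} where
  carrier := ULift.{u} Prop
  top := ⊤
  pt := ⟨False⟩

/-- The Sierpinski space with a prescribed base point. -/
def sierpinski (b : Prop) : PointedTop.{u} where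
  carrier := ULift.{u} Prop
  pt := ⟨b⟩

/-- The spaces that detect embeddings. -/
inductive EmbeddingTest : PointedTop.{u} → Prop
  | indiscrete : EmbeddingTest indiscrete
  | sierpinski (b : Prop) : EmbeddingTest (sierpinski b)

/-- The maps to the one-point space from the spaces that detect embeddings. -/
inductive embeddingTestMaps : MorphismProperty PointedTop.{u}
  | intro {T : PointedTop.{u}} (hT : EmbeddingTest T) :
      embeddingTestMaps (trivialMap T onePoint)

/-- Pointed maps along which all maps to the test spaces extend. -/
abbrev embeddings : MorphismProperty PointedTop.{u} := embeddingTestMaps.llp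

theorem embeddings_iff {f : X ⟶ Y} :
    embeddings f ↔ ∀ T : PointedTop.{u}, EmbeddingTest T → ∀ g : X ⟶ T, ∃ h : Y ⟶ T,
      f ≫ h = g := by
  constructor
  · intro hf T hT g
    have := hf _ (embeddingTestMaps.intro hT)
    have sq : CommSq g f (trivialMap T onePoint) (trivialMap Y onePoint) := ⟨rfl⟩
    exact ⟨sq.lift, sq.fac_left⟩
  · rintro h _ _ _ ⟨hT⟩
    refine ⟨fun {g k} sq => ?_⟩
    obtain ⟨l, hl⟩ := h _ hT g
    exact ⟨⟨l, hl, rfl⟩⟩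

/-- A pointed map to the indiscrete space from a set. -/
def toIndiscrete (s : Set X) (hs : X.pt ∉ s) : X ⟶ indiscrete where
  map := ⟨fun x => ⟨x ∈ s⟩, continuous_top⟩
  map_pt := congrArg ULift.up (eq_false hs)

/-- A pointed map to the Sierpinski space from an open set. -/
def toSierpinski (s : Set X) (hs : IsOpen s) : X ⟶ sierpinski (X.pt ∈ s) where
  map := ⟨fun x => ⟨x ∈ s⟩, continuous_uliftUp.comp (continuous_Prop.2 hs)⟩
  map_pt := rfl

/-- An open set is a map to the Sierpinski space, and extending the map along `f` exhibits the set
as a preimage. Both choices of base point are needed, since the set may or may not contain the base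
point. -/
theorem embeddings.isInducing {f : X ⟶ Y} (hf : embeddings f) : Topology.IsInducing f.map := by
  refine ⟨le_antisymm f.map.continuous.le_induced fun s hs => ?_⟩
  obtain ⟨h, hh⟩ := embeddings_iff.1 hf _ (.sierpinski _) (toSierpinski s hs)
  refine ⟨{y | (h.map y).down}, continuous_Prop.1 (continuous_uliftDown.comp h.map.continuous),
    Set.ext fun x => ?_⟩
  exact iff_of_eq (congrArg (fun k : X ⟶ sierpinski _ => (k.map x).down) hh)

theorem embeddings.injective {f : X ⟶ Y} (hf : embeddings f) : Function.Injective f.map := by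
  intro x y hxy
  wlog hy : y ≠ X.pt generalizing x y
  · by_cases hx : x = X.pt
    · exact hx.trans (not_not.1 hy).symm
    · exact (this hxy.symm hx).symm
  obtain ⟨h, hh⟩ := embeddings_iff.1 hf _ .indiscrete (toIndiscrete {y} hy.symm)
  have h1 : ∀ z, (h.map (f.map z)).down = (z ∈ ({y} : Set X)) := fun z =>
    congrArg (fun k : X ⟶ indiscrete => (k.map z).down) hh
  have := (h1 x).symm.trans ((congrArg (fun z => (h.map z).down) hxy).trans (h1 y))
  exact this.mpr rfl

theorem embeddings_of_retraction {f : X ⟶ Y} (r : Y ⟶ X) (h : f ≫ r = 𝟙 X) : embeddings f :=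
  embeddings_iff.2 fun _ _ g => ⟨r ≫ g, by rw [← Category.assoc, h, Category.id_comp]⟩

/-- The inclusion `x ↦ [x, 1]` into the top of the reduced cylinder. -/
def cylTop (X : PointedTop.{u}) : X ⟶ cyl X where
  map := (collapseMk _).comp ⟨fun x => (x, 1), by fun_prop⟩
  map_pt := collapseMk_eq_pt rfl

/-- The inclusion of both ends of the reduced cylinder. -/
def cylEnds (X : PointedTop.{u}) : wedge X X ⟶ cyl X :=
  wedgeDesc (cylBottom X) (cylTop X)

theorem wedge_hom_ext {f g : wedge X Y ⟶ Z} (h₁ : wedgeInl X Y ≫ f = wedgeInl X Y ≫ g)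
    (h₂ : wedgeInr X Y ≫ f = wedgeInr X Y ≫ g) : f = g := by
  refine hom_ext fun w => ?_
  obtain ⟨x | y, rfl⟩ := collapseMk_surjective w
  · exact congrArg (fun k : X ⟶ Z => k.map x) h₁
  · exact congrArg (fun k : Y ⟶ Z => k.map y) h₂

theorem wedgeInl_desc (f : X ⟶ Z) (g : Y ⟶ Z) : wedgeInl X Y ≫ wedgeDesc f g = f := rfl

theorem wedgeInr_desc (f : X ⟶ Z) (g : Y ⟶ Z) : wedgeInr X Y ≫ wedgeDesc f g = g := rfl

theorem embeddings_cylBottom (X : PointedTop.{u}) : embeddings (cylBottom X) :=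
  embeddings_of_retraction (collapseDesc ⟨Prod.fst, continuous_fst⟩ fun _ h => h) rfl

theorem embeddings_cylEnds (X : PointedTop.{u}) : embeddings (cylEnds X) := by
  rw [embeddings_iff]
  suffices key : ∀ T : PointedTop.{u}, EmbeddingTest T → ∀ f g : X ⟶ T,
      ∃ h : X ⟶ path T, h ≫ pathEv T 0 = f ∧ h ≫ pathEv T 1 = g by
    intro T hT g
    obtain ⟨h, h0, h1⟩ := key T hT (wedgeInl X X ≫ g) (wedgeInr X X ≫ g)
    exact ⟨((cylExchange X).equiv T).symm h, wedge_hom_ext h0 h1⟩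
  intro T hT f g
  rcases hT with ⟨⟩ | ⟨b⟩
  · refine ⟨toPath ⟨fun q => if q.2 = 0 then f.map q.1 else g.map q.1, continuous_top⟩
      (fun t => ?_), hom_ext fun x => if_pos rfl, hom_ext fun x => if_neg one_ne_zero⟩
    change (if t = 0 then f.map X.pt else g.map X.pt) = _
    split_ifs
    · exact f.map_pt
    · exact g.map_pt
  · have hf := continuous_Prop.1 (continuous_uliftDown.comp f.map.continuous)
    have hg := continuous_Prop.1 (continuous_uliftDown.comp g.map.continuous)
    -- For open sets `U`, `V` given at the two ends, take `U × [0, 1/2) ∪ V × (1/2, 1] ∪ (U ∩ V) ×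
    -- I`. The last piece keeps the whole line over the base point inside when the base point lies
    -- in `U` and `V`.
    refine ⟨toPath ⟨fun q => (⟨((f.map q.1).down ∧ (q.2 : ℝ) < 1 / 2) ∨
        ((g.map q.1).down ∧ 1 / 2 < (q.2 : ℝ)) ∨ ((f.map q.1).down ∧ (g.map q.1).down)⟩ :
        ULift Prop), ?_⟩ (fun t => ?_), hom_ext fun x => ?_, hom_ext fun x => ?_⟩
    · have hf' := hf.preimage (continuous_fst (Y := I))
      have hg' := hg.preimage (continuous_fst (Y := I))
      have h1 : IsOpen {q : X × I | (q.2 : ℝ) < 1 / 2} :=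
        isOpen_lt (by fun_prop) continuous_const
      have h2 : IsOpen {q : X × I | 1 / 2 < (q.2 : ℝ)} :=
        isOpen_lt continuous_const (by fun_prop)
      exact continuous_uliftUp.comp (continuous_Prop.2
        ((hf'.inter h1).union ((hg'.inter h2).union (hf'.inter hg'))))
    · refine congrArg ULift.up (propext ?_)
      change (((f.map X.pt).down ∧ (t : ℝ) < 1 / 2) ∨ ((g.map X.pt).down ∧ 1 / 2 < (t : ℝ)) ∨
        ((f.map X.pt).down ∧ (g.map X.pt).down)) ↔ b
      rw [f.map_pt, g.map_pt]
      change ((b ∧ _) ∨ (b ∧ _) ∨ (b ∧ b)) ↔ b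
      tauto
    · refine congrArg ULift.up (propext ?_)
      change (((f.map x).down ∧ (0 : ℝ) < 1 / 2) ∨ ((g.map x).down ∧ 1 / 2 < (0 : ℝ)) ∨
        ((f.map x).down ∧ (g.map x).down)) ↔ (f.map x).down
      norm_num
      exact fun h _ => h
    · refine congrArg ULift.up (propext ?_)
      change (((f.map x).down ∧ (1 : ℝ) < 1 / 2) ∨ ((g.map x).down ∧ 1 / 2 < (1 : ℝ)) ∨
        ((f.map x).down ∧ (g.map x).down)) ↔ (g.map x).down
      norm_num

end

end PointedTop

namespace PointedTop

open Limits MorphismProperty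

/-! ### The small object argument -/

section

/-- Embeddings form a class defined by a left lifting property, so cell attachments stay in it. -/
theorem pushouts_coproducts_le_embeddings {S : MorphismProperty PointedTop.{u}}
    (hI : S ≤ embeddings) : (coproducts.{u} S).pushouts ≤ embeddings := by
  have h : (coproducts.{u} S).pushouts ≤ S.rlp.llp := by
    rw [← rlp_coproducts.{u} S]
    exact pushouts_le_llp_rlp _
  exact h.trans (antitone_llp ((le_llp_iff_le_rlp _ _).1 hI))

/-- The indicator function of the points missed by every leg is continuous into the indiscrete space
and agrees with the trivial map on each leg, hence is trivial. -/
theorem exists_eq_ι_app {J : Type*} [Category J] {F : J ⥤ PointedTop.{u}} [Nonempty J]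
    {c : Cocone F} (hc : IsColimit c) (x : c.pt) : ∃ j y, (c.ι.app j).map y = x := by
  let s : Set c.pt := {x | ¬ ∃ j y, (c.ι.app j).map y = x}
  have hs : c.pt.pt ∉ s := not_not.2 ⟨Classical.arbitrary J, _, (c.ι.app _).map_pt⟩
  have h : toIndiscrete s hs = trivialMap c.pt indiscrete := hc.hom_ext fun j => hom_ext fun y =>
    congrArg ULift.up (eq_false (not_not.2 ⟨j, y, rfl⟩))
  have := congrArg (fun k : c.pt ⟶ indiscrete => (k.map x).down) h
  exact not_not.1 (of_eq_false this)

/-- A continuous map factors through an embedding if it does so as a map of sets. -/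
theorem embeddings.exists_factorization {X Y Z : PointedTop.{u}} {f : X ⟶ Y} (hf : embeddings f)
    (g : Z ⟶ Y) (h : ∀ z, ∃ x, f.map x = g.map z) : ∃ k : Z ⟶ X, k ≫ f = g := by
  choose k hk using h
  refine ⟨⟨⟨k, hf.isInducing.continuous_iff.2 ?_⟩, hf.injective ?_⟩, hom_ext hk⟩
  · exact g.map.continuous.congr fun z => (hk z).symm
  · exact (hk _).trans (g.map_pt.trans f.map_pt.symm)

/-- Each point of the image of `Z` appears at some stage. Fewer than `κ` stages have a common bound,
and there the map factors as a map of sets, hence continuously, because the stages embed in the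
colimit. Injectivity of the same embeddings gives uniqueness. -/
theorem preservesColimit_coyoneda {κ : Cardinal.{u}} [Fact κ.IsRegular] [OrderBot κ.ord.ToType]
    {X Y Z : PointedTop.{u}} {f : X ⟶ Y} (hZ : HasCardinalLT Z κ)
    (h : embeddings.TransfiniteCompositionOfShape κ.ord.ToType f) :
    PreservesColimit h.F (coyoneda.obj (Opposite.op Z)) := by
  have hemb : ∀ j, embeddings (h.incl.app j) := fun j =>
    transfiniteCompositionsOfShape_le _ _ _ (h.ici j).mem
  have := isFiltered_of_isCardinalFiltered κ.ord.ToType κ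
  refine preservesColimit_of_preserves_colimit_cocone h.isColimit
    (Types.FilteredColimit.isColimitOf' _ _ ?_ ?_)
  · intro g
    change Z ⟶ Y at g
    choose j y hy using fun z => exists_eq_ι_app h.isColimit (g.map z)
    obtain ⟨k, hk⟩ := (hemb (IsCardinalFiltered.max j hZ)).exists_factorization g fun z =>
      ⟨(h.F.map (IsCardinalFiltered.toMax j hZ z)).map (y z), by
        rw [← hy z, ← comp_map, h.incl.naturality]
        rfl⟩
    exact ⟨_, k, hk.symm⟩
  · intro j a b hab
    exact ⟨j, 𝟙 j, congrArg _ (hom_ext fun z => (hemb j).injective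
      (congrArg (fun k : Z ⟶ Y => k.map z) hab))⟩

theorem hasSmallObjectArgument_of_le_embeddings (S : MorphismProperty PointedTop.{u})
    [IsSmall.{u} S] (hI : S ≤ embeddings) : HasSmallObjectArgument.{u} S := by
  obtain ⟨κ, hκ, h⟩ := HasCardinalLT.exists_regular_cardinal_forall.{u}
    (fun f : S.toSet => (f.1.left : Type u))
  have : Fact κ.IsRegular := ⟨hκ⟩
  have : Nonempty κ.ord.ToType := by simpa using hκ.ne_zero
  let := WellFoundedLT.toOrderBot κ.ord.ToType
  refine ⟨κ, inferInstance, inferInstance, { preservesColimit := ?_ }⟩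
  intro A B X Y i hi f hf
  exact preservesColimit_coyoneda (h ⟨Arrow.mk i, hi⟩)
    (hf.transfiniteCompositionOfShape.ofLE
      (pushouts_coproducts_le_embeddings (by rwa [ofHoms_homFamily])))

end

/-! ### Generating cofibrations -/

section

variable {A Z E B : PointedTop.{u}} {p : E ⟶ B}

/-- The generating cofibrations. -/
def generatingCof (A : PointedTop.{u}) : MorphismProperty PointedTop.{u} :=
  (ofHoms fun n : ℕ => trivialMap onePoint (iterSusp A n)) ⊔
    ((ofHoms fun n : ℕ => cylEnds (iterSusp A n)) ⊔
      ofHoms fun n : ℕ => cylBottom (iterCyl A n))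

instance (A : PointedTop.{u}) : IsSmall.{u} (generatingCof A) := by
  have sup {W W' : MorphismProperty PointedTop.{u}} [IsSmall.{u} W] [IsSmall.{u} W'] :
      IsSmall.{u} (W ⊔ W') := by
    have : (W ⊔ W').toSet = W.toSet ∪ W'.toSet := rfl
    exact ⟨by rw [this]; infer_instance⟩
  have := @sup
  have (X : ℕ → PointedTop.{u}) (Y : ℕ → PointedTop.{u}) (f : ∀ n, X n ⟶ Y n) :
      IsSmall.{u} (ofHoms f) := isSmall_ofHoms.{u} f
  exact sup (W' := _ ⊔ _)

theorem generatingCof_le_embeddings (A : PointedTop.{u}) : generatingCof A ≤ embeddings := by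
  refine sup_le ?_ (sup_le ?_ ?_)
  · rintro _ _ _ ⟨n⟩
    exact embeddings_of_retraction (trivialMap _ _) rfl
  · rintro _ _ _ ⟨n⟩
    exact embeddings_cylEnds _
  · rintro _ _ _ ⟨n⟩
    exact embeddings_cylBottom _

theorem hasLiftingProperty_cylEnds_iff : HasLiftingProperty (cylEnds Z) p ↔ Full Z p := by
  have key0 : ∀ {X : PointedTop.{u}} (f : cyl Z ⟶ X),
      wedgeInl Z Z ≫ cylEnds Z ≫ f = (cylExchange Z).equiv X f ≫ pathEv X 0 := fun _ => rfl
  have key1 : ∀ {X : PointedTop.{u}} (f : cyl Z ⟶ X),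
      wedgeInr Z Z ≫ cylEnds Z ≫ f = (cylExchange Z).equiv X f ≫ pathEv X 1 := fun _ => rfl
  constructor
  · intro h f g G hf hg
    obtain ⟨G, rfl⟩ := ((cylExchange Z).equiv B).surjective G
    rw [← key0] at hf
    rw [← key1] at hg
    have sq : CommSq (wedgeDesc f g) (cylEnds Z) p G := ⟨wedge_hom_ext hf.symm hg.symm⟩
    have := h.sq_hasLift sq
    refine ⟨(cylExchange Z).equiv E sq.lift, ?_, ?_, ?_⟩
    · rw [← key0, sq.fac_left]; rfl
    · rw [← key1, sq.fac_left]; rfl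
    · exact congrArg ((cylExchange Z).equiv B) sq.fac_right
  · intro h
    refine ⟨fun {f g} sq => ?_⟩
    obtain ⟨F, hF, hF', hF''⟩ := h (wedgeInl Z Z ≫ f) (wedgeInr Z Z ≫ f)
      ((cylExchange Z).equiv B g) (by rw [← key0, ← sq.w]; rfl) (by rw [← key1, ← sq.w]; rfl)
    obtain ⟨F, rfl⟩ := ((cylExchange Z).equiv E).surjective F
    exact ⟨⟨F, wedge_hom_ext hF hF', ((cylExchange Z).equiv B).injective hF''⟩⟩

/-- Trivial fibrations are stable under loops, so the case `n = 0` applied to the iterated loop map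
suffices. -/
theorem full_iterSusp
    (hA : ∀ {E B : PointedTop.{u}} (p : E ⟶ B), fib A p → weq A p → Full A p)
    {E B : PointedTop.{u}} {p : E ⟶ B} (hp : fib A p) (hw : weq A p) (n : ℕ) :
    Full (iterSusp A n) p := by
  induction n generalizing E B with
  | zero => exact hA p hp hw
  | succ n ih => exact ((suspExchange _).full_iff p).2 (ih hp.map_loop hw.map_loop)

/-- The bottoms of the cubes detect fibrations, the base points of `ΣⁿA` give surjectivity on
homotopy classes, and the cylinder ends give injectivity. In the converse direction only the
cylinder ends need `hA`, since a lift up to homotopy from `ΣⁿA` is corrected by homotopy lifting. -/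
theorem rlp_generatingCof
    (hA : ∀ {E B : PointedTop.{u}} (p : E ⟶ B), fib A p → weq A p → Full A p) :
    (generatingCof A).rlp = fib A ⊓ weq A := by
  refine le_antisymm ?_ ?_
  · intro E B p hp
    refine ⟨fib_iff.2 fun k => hasHLP_iff.1 (hp _ (Or.inr (Or.inr ⟨k⟩))),
      weq_iff.2 fun n => ⟨fun f g hfg => ?_, fun b => ?_⟩⟩
    · obtain ⟨G, h0, h1⟩ := homotopic_iff.1 hfg
      obtain ⟨F, h0, h1, -⟩ := hasLiftingProperty_cylEnds_iff.1
        (hp _ (Or.inr (Or.inl ⟨n⟩))) f g G h0 h1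
      exact homotopic_iff.2 ⟨F, h0, h1⟩
    · have := hp _ (Or.inl ⟨n⟩)
      have sq : CommSq (trivialMap onePoint E) (trivialMap onePoint (iterSusp A n)) p b :=
        ⟨hom_ext fun _ => p.map_pt.trans b.map_pt.symm⟩
      exact ⟨sq.lift, by rw [sq.fac_right]; exact .refl _⟩
  · rintro E B p ⟨hp, hw⟩
    rintro _ _ _ (⟨⟨n⟩⟩ | ⟨⟨n⟩⟩ | ⟨⟨n⟩⟩)
    · refine ⟨fun {e b} sq => ?_⟩
      obtain ⟨f, hf⟩ := (weq_iff.1 hw n).2 b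
      obtain ⟨G, h0, h1⟩ := homotopic_iff.1 hf
      obtain ⟨F, -, hF⟩ := (fib_iff.1 hp).hlp_iterSusp n f G h0
      refine ⟨⟨F ≫ pathEv E 1, hom_ext fun _ => ?_, ?_⟩⟩
      · exact (Hom.map_pt (trivialMap onePoint _ ≫ F ≫ pathEv E 1)).trans e.map_pt.symm
      · rw [Category.assoc, ← pathFunctor_map_ev, ← Category.assoc, hF, h1]
    · exact hasLiftingProperty_cylEnds_iff.2 (full_iterSusp hA hp hw n)
    · exact hasHLP_iff.2 (fib_iff.1 hp n)

end

/-! ### The model structure -/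

section

open HomotopicalAlgebra

variable {A : PointedTop.{u}}

instance (A : PointedTop.{u}) : (fib A).IsStableUnderRetracts where
  of_retract {_ _ _ _ f g} h hg := by
    refine fib_iff.2 fun k => hasHLP_iff.1 ?_
    have : HasLiftingProperty (cylBottom (iterCyl A k)) g := hasHLP_iff.2 (fib_iff.1 hg k)
    exact h.rightLiftingProperty _

theorem Bij.of_retract {Z X Y X' Y' : PointedTop.{u}} {f : X ⟶ Y} {g : X' ⟶ Y'}
    (h : RetractArrow f g) (hg : Bij Z g) : Bij Z f := by
  refine ⟨fun a b hab => ?_, fun b => ?_⟩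
  · have := (hg.1 (a ≫ h.i.left) (b ≫ h.i.left) (by
      rw [Category.assoc, Category.assoc, h.i_w]
      simpa only [Category.assoc] using hab.comp_right h.i.right)).comp_right h.r.left
    simpa only [Category.assoc, h.retract_left, Category.comp_id] using this
  · obtain ⟨c, hc⟩ := hg.2 (b ≫ h.i.right)
    refine ⟨c ≫ h.r.left, ?_⟩
    have := hc.comp_right h.r.right
    rw [Category.assoc, Category.assoc, ← h.r_w, h.retract_right, Category.comp_id] at this
    rwa [Category.assoc]

instance (A : PointedTop.{u}) : (weq A).IsStableUnderRetracts where
  of_retract h hg := weq_iff.2 fun n => (weq_iff.1 hg n).of_retract h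

theorem fib_comp {X Y Z : PointedTop.{u}} {f : X ⟶ Y} {g : Y ⟶ Z} (hf : fib A f) (hg : fib A g) :
    fib A (f ≫ g) := by
  refine fib_iff.2 fun k => hasHLP_iff.1 ?_
  have h1 : HasLiftingProperty (cylBottom (iterCyl A k)) f := hasHLP_iff.2 (fib_iff.1 hf k)
  have h2 : HasLiftingProperty (cylBottom (iterCyl A k)) g := hasHLP_iff.2 (fib_iff.1 hg k)
  exact inferInstanceAs (HasLiftingProperty (cylBottom (iterCyl A k)) (f ≫ g))

theorem isModelStructure
    (hA : ∀ {E B : PointedTop.{u}} (p : E ⟶ B), fib A p → weq A p → Full A p) :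
    IsModelStructure (fib A) (cof A) (weq A) := by
  have hrlp := rlp_generatingCof (A := A) hA
  have := hasSmallObjectArgument_of_le_embeddings _ (generatingCof_le_embeddings A)
  have hcof : cof A = (generatingCof A).rlp.llp := by rw [hrlp]; rfl
  let : CategoryWithFibrations PointedTop.{u} := ⟨fib A⟩
  let : CategoryWithCofibrations PointedTop.{u} := ⟨cof A⟩
  let : CategoryWithWeakEquivalences PointedTop.{u} := ⟨weq A⟩
  have : (weakEquivalences PointedTop.{u}).HasTwoOutOfThreeProperty :=
    inferInstanceAs (weq A).HasTwoOutOfThreeProperty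
  have hfac : HasFactorization (cof A) (fib A ⊓ weq A) := by
    rw [hcof, ← hrlp]
    infer_instance
  have h1 : IsWeakFactorizationSystem (cof A) (fib A ⊓ weq A) :=
    { rlp := by rw [hcof, rlp_llp_rlp, hrlp]
      llp := rfl }
  -- Factor `f` through its mapping path space, then factor the inclusion, a weak equivalence, into
  -- a cofibration and a trivial fibration. By two-out-of-three that cofibration is trivial.
  have hfac' : HasFactorization (cof A ⊓ weq A) (fib A) := ⟨fun {X Y} f => by
    let d := factorizationData (cof A) (fib A ⊓ weq A) (pathFiberIncl f)
    exact ⟨{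
      Z := d.Z
      i := d.i
      p := d.p ≫ pathFiberEnd f
      fac := by rw [← Category.assoc, d.fac]; rfl
      hi := ⟨d.hi, (weq A).of_postcomp (W' := weq A) d.i d.p d.hp.2
        (by rw [d.fac]; exact weq_pathFiberIncl f)⟩
      hp := fib_comp d.hp.1 (fib_pathFiberEnd f) }⟩⟩
  have hcofRetract : (cof A).IsStableUnderRetracts :=
    inferInstanceAs (fib A ⊓ weq A).llp.IsStableUnderRetracts
  have h2 : IsWeakFactorizationSystem (cof A ⊓ weq A) (fib A) :=
    IsWeakFactorizationSystem.mk' _ _ fun i p hi hp => trivialCof_hasLiftingProperty hi.1 hi.2 hp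
  have : IsWeakFactorizationSystem (cofibrations PointedTop.{u})
    (trivialFibrations PointedTop.{u}) := h1
  have : IsWeakFactorizationSystem (trivialCofibrations PointedTop.{u})
    (fibrations PointedTop.{u}) := h2
  exact ⟨ModelCategory.mk' _, rfl, rfl, rfl⟩

end

end PointedTop

namespace PointedTop

/-! ### Exchanging suspensions and cylinders -/

section

variable {Z Z' E B X Y : PointedTop.{u}} {G : PointedTop.{u} ⥤ PointedTop.{u}} {p : E ⟶ B}

namespace Exchange

/-- The exchange for cylinders. -/
def cyl (e : Exchange Z' Z G) : Exchange (cyl Z') (cyl Z) G where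
  toPathComm := e.toPathComm
  equiv X := ((cylExchange Z').equiv X).trans
    ((e.pathEquiv X).trans ((cylExchange Z).equiv (G.obj X)).symm)
  equiv_comp f g := ((cylExchange Z).equiv _).injective <| by
    rw [(cylExchange Z).equiv_comp]
    simp only [Equiv.trans_apply, Equiv.apply_symm_apply]
    rw [(cylExchange Z').equiv_comp, e.pathEquiv_map]

/-- The trivial map factors through the one-point space, and the bijection leaves only one map from
`Z` to the value of `G` there. This lets the exchange pass to suspensions, seen as homotopies
between trivial maps. -/
theorem equiv_trivialMap (e : Exchange Z' Z G) (X : PointedTop.{u}) :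
    e.equiv X (trivialMap Z' X) = trivialMap Z (G.obj X) := by
  have h : trivialMap Z (G.obj onePoint) = e.equiv onePoint (trivialMap Z' onePoint) :=
    (e.equiv onePoint).symm.injective (hom_ext fun _ => rfl)
  have h' := e.equiv_comp (trivialMap Z' onePoint) (trivialMap onePoint X)
  rw [← h] at h'
  exact h'.trans (hom_ext fun _ => Hom.map_pt (G.map (trivialMap onePoint X)))

/-- Maps out of a suspension are homotopies between constant maps. -/
def suspEquiv (Z X : PointedTop.{u}) : (susp Z ⟶ X) ≃
    {F : Z ⟶ path X // F ≫ pathEv X 0 = trivialMap Z X ∧ F ≫ pathEv X 1 = trivialMap Z X} :=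
  ((suspExchange Z).equiv X).trans
    { toFun := fun F => ⟨toPath (ofRel F) (relPath_map_pt F),
        hom_ext fun z => (F.map z).2 0 (by simp), hom_ext fun z => (F.map z).2 1 (by simp)⟩
      invFun := fun F => toRel (ofRel F.1) (relPath_map_pt F.1) (by
        rintro z c (rfl | rfl)
        · exact congrArg (fun f : Z ⟶ X => f.map z) F.2.1
        · exact congrArg (fun f : Z ⟶ X => f.map z) F.2.2)
      left_inv := fun _ => rfl
      right_inv := fun _ => rfl }

theorem suspEquiv_comp (f : susp Z ⟶ X) (g : X ⟶ Y) :
    (suspEquiv Z Y (f ≫ g)).1 = (suspEquiv Z X f).1 ≫ pathFunctor.map g := rfl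

/-- The exchange for suspensions. -/
def susp (e : Exchange Z' Z G) : Exchange (susp Z') (susp Z) G where
  toPathComm := e.toPathComm
  equiv X := (suspEquiv Z' X).trans
    (((e.pathEquiv X).subtypeEquiv fun F => by
      rw [e.pathEquiv_ev, e.pathEquiv_ev, ← e.equiv_trivialMap, (e.equiv X).apply_eq_iff_eq,
        (e.equiv X).apply_eq_iff_eq]).trans (suspEquiv Z (G.obj X)).symm)
  equiv_comp f g := (suspEquiv Z _).injective <| Subtype.ext <| by
    rw [suspEquiv_comp]
    simp only [Equiv.trans_apply, Equiv.apply_symm_apply, Equiv.subtypeEquiv_apply]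
    rw [suspEquiv_comp, e.pathEquiv_map]

/-- The exchange for iterated cylinders. -/
def iterCyl (e : Exchange Z' Z G) : ∀ k, Exchange (iterCyl Z' k) (iterCyl Z k) G
  | 0 => e
  | k + 1 => (e.iterCyl k).cyl

/-- The exchange for iterated suspensions. -/
def iterSusp (e : Exchange Z' Z G) : ∀ k, Exchange (iterSusp Z' k) (iterSusp Z k) G
  | 0 => e
  | k + 1 => (e.iterSusp k).susp

theorem fib_iff (e : Exchange Z' Z G) : fib Z' p ↔ fib Z (G.map p) :=
  PointedTop.fib_iff.trans
    ((forall_congr' fun k => (e.iterCyl k).hlp_iff p).trans PointedTop.fib_iff.symm)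

theorem weq_iff (e : Exchange Z' Z G) : weq Z' p ↔ weq Z (G.map p) :=
  PointedTop.weq_iff.trans
    ((forall_congr' fun k => (e.iterSusp k).bij_iff p).trans PointedTop.weq_iff.symm)

end Exchange

end

/-! ### Lifting paths up to homotopy -/

section

variable {M N : Type*} [TopologicalSpace M] [TopologicalSpace N]

/-- The naturality square of a homotopy at a path. -/
theorem homotopic_evalAt {f g : C(M, N)} (h : f.Homotopy g) {a b : M} (δ : Path a b) :
    ((δ.map f.continuous).trans (h.evalAt b)).Homotopic
      ((h.evalAt a).trans (δ.map g.continuous)) := by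
  let k : C(I × I, N) := ⟨fun q => h (q.1, δ q.2), by fun_prop⟩
  let p₁ : Path ((0, 0) : I × I) (0, 1) := ⟨⟨fun t => (0, t), by fun_prop⟩, rfl, rfl⟩
  let p₂ : Path ((0, 1) : I × I) (1, 1) := ⟨⟨fun t => (t, 1), by fun_prop⟩, rfl, rfl⟩
  let p₃ : Path ((0, 0) : I × I) (1, 0) := ⟨⟨fun t => (t, 0), by fun_prop⟩, rfl, rfl⟩
  let p₄ : Path ((1, 0) : I × I) (1, 1) := ⟨⟨fun t => (1, t), by fun_prop⟩, rfl, rfl⟩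
  have : ContractibleSpace I := (convex_Icc (0 : ℝ) 1).contractibleSpace ⟨0, by simp⟩
  -- The two ways around the square are homotopic because the square is simply connected; `k`
  -- carries this to `N`.
  have h0 : Path.Homotopic (p₁.trans p₂) (p₃.trans p₄) := SimplyConnectedSpace.paths_homotopic _ _
  have h1 := h0.map k
  have e0 : f a = k (0, 0) := by simp [k]
  have e1 : g b = k (1, 1) := by simp [k]
  have e2 : ((δ.map f.continuous).trans (h.evalAt b)) =
      (((p₁.trans p₂).map k.continuous).cast e0 e1) := by
    rw [Path.map_trans]
    ext t
    simp only [Path.trans_apply, Path.cast_coe]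
    split_ifs <;> simp [k, p₁, p₂, ContinuousMap.Homotopy.evalAt]
  have e3 : ((h.evalAt a).trans (δ.map g.continuous)) =
      (((p₃.trans p₄).map k.continuous).cast e0 e1) := by
    rw [Path.map_trans]
    ext t
    simp only [Path.trans_apply, Path.cast_coe]
    split_ifs <;> simp [k, p₃, p₄, ContinuousMap.Homotopy.evalAt]
  rw [e2, e3]
  exact h1

variable (P : C(M, N))

/-- `P` is injective on path components and surjective on fundamental groups at the point `m`. -/
structure BijectiveAt (m : M) : Prop where
  joined : ∀ x, Joined (P x) (P m) → Joined x m
  loop : ∀ ω : Path (P m) (P m), ∃ ω' : Path m m, (ω'.map P.continuous).Homotopic ω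

variable {P}

/-- Choose `κ` from `b` to `m`; injectivity on components gives `ε` from `a` to `m`. Lift the loop
`(Pε)⁻¹ · δ · Pκ` to `ω`; then `ε · ω · κ⁻¹` is the required path. -/
theorem BijectiveAt.exists_path {m : M} (h : BijectiveAt P m) {a b : M} (hb : Joined b m)
    (δ : Path (P a) (P b)) : ∃ γ : Path a b, (γ.map P.continuous).Homotopic δ := by
  obtain ⟨κ⟩ := hb
  obtain ⟨ε⟩ := h.joined a ⟨δ.trans (κ.map P.continuous)⟩
  obtain ⟨ω, hω⟩ := h.loop (((ε.map P.continuous).symm.trans δ).trans (κ.map P.continuous))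
  refine ⟨ε.trans (ω.trans κ.symm), ?_⟩
  open Path.Homotopic.Quotient in
  rw [← Path.Homotopic.Quotient.eq] at hω ⊢
  simp only [Path.map_trans, ← Path.map_symm, mk_trans, mk_symm] at hω ⊢
  rw [hω]
  simp only [trans_assoc, trans_symm, trans_refl]
  rw [← trans_assoc, trans_symm, refl_trans]

/-- Translations of `M` and `N`, compatible with `P`, that invert each other up to homotopy. -/
structure Translation (P : C(M, N)) where
  /-- the translation of `M` -/
  R : C(M, M)
  /-- the inverse translation of `M` -/
  R' : C(M, M)
  /-- the translation of `N` -/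
  S : C(N, N)
  /-- the inverse translation of `N` -/
  S' : C(N, N)
  map_R : ∀ x, P (R x) = S (P x)
  map_R' : ∀ x, P (R' x) = S' (P x)
  /-- the homotopy on `M` -/
  h : (R'.comp R).Homotopy (.id M)
  /-- the homotopy on `N` -/
  k : (S'.comp S).Homotopy (.id N)
  map_h : ∀ q, P (h q) = k (q.1, P q.2)

theorem homotopic_of_cast {a a' b b' c d : N} (ha : a' = a) (hb : b' = b) {k : Path a c}
    {q : Path a b} {l : Path b d} {δ : Path c d} (H : (q.trans l).Homotopic (k.trans δ)) :
    ((k.cast ha rfl).symm.trans ((q.cast ha hb).trans (l.cast hb rfl))).Homotopic δ := by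
  subst ha hb
  open Path.Homotopic.Quotient in
  rw [← Path.Homotopic.Quotient.eq] at H ⊢
  simp only [Path.cast_rfl_rfl, mk_trans, mk_symm] at H ⊢
  rw [H, ← trans_assoc, symm_trans, refl_trans]

/-- Translate `δ` so that its end lies under the component of `m`, lift it there, translate the lift
back, and conjugate with the traces of `R' ∘ R ≃ id`. Since `P` sends these traces to those of `S' ∘
S ≃ id`, naturality of the latter homotopy along `δ` gives the result. -/
theorem BijectiveAt.exists_path_of_translation {m : M} (h : BijectiveAt P m) (T : Translation P)
    {x y : M} (hy : Joined (T.R y) m) (δ : Path (P x) (P y)) :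
    ∃ γ : Path x y, (γ.map P.continuous).Homotopic δ := by
  obtain ⟨γ, hγ⟩ := h.exists_path hy ((δ.map T.S.continuous).cast (T.map_R x) (T.map_R y))
  have ex : P (T.R' (T.R x)) = T.S' (T.S (P x)) := by rw [T.map_R', T.map_R]
  have ey : P (T.R' (T.R y)) = T.S' (T.S (P y)) := by rw [T.map_R', T.map_R]
  have h1 := (hγ.map T.S').pathCast (T.map_R' (T.R x)) (T.map_R' (T.R y))
  -- The traces at `z`, with their end points written out; the cast accounts for `P (R' (R z)) = S'
  -- (S (P z))`.
  have key : ∀ z, ∃ (η : Path (T.R' (T.R z)) z) (ζ : Path (T.S' (T.S (P z))) (P z)),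
      η.map P.continuous = ζ.cast (by rw [T.map_R', T.map_R]) rfl ∧ ζ = T.k.evalAt (P z) :=
    fun z => ⟨T.h.evalAt z, T.k.evalAt (P z), Path.ext (funext fun t => T.map_h (t, z)), rfl⟩
  obtain ⟨ηx, ζx, hx, hx'⟩ := key x
  obtain ⟨ηy, ζy, hy, hy'⟩ := key y
  have nat : (((δ.map T.S.continuous).map T.S'.continuous).trans ζy).Homotopic (ζx.trans δ) := by
    subst hx' hy'
    exact homotopic_evalAt T.k δ
  refine ⟨ηx.symm.trans ((γ.map T.R'.continuous).trans ηy), ?_⟩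
  have e2 : (γ.map T.R'.continuous).map P.continuous =
      ((γ.map P.continuous).map T.S'.continuous).cast (T.map_R' _) (T.map_R' _) :=
    Path.ext (funext fun t => T.map_R' _)
  rw [Path.map_trans, Path.map_trans, ← Path.map_symm, hx, hy, e2]
  have e3 : ((((δ.map T.S.continuous).cast (T.map_R x) (T.map_R y)).map T.S'.continuous).cast
      (T.map_R' (T.R x)) (T.map_R' (T.R y))) =
      ((δ.map T.S.continuous).map T.S'.continuous).cast ex ey := Path.ext rfl
  rw [e3] at h1
  exact ((Path.Homotopic.refl _).hcomp (h1.hcomp (Path.Homotopic.refl _))).trans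
    (homotopic_of_cast ex ey nat)

end

/-! ### Lifting paths with prescribed ends -/

section

variable {E B X : PointedTop.{u}} {p : E ⟶ B}

theorem homotopic_twoPoint_iff {x y : X} :
    Homotopic ((twoPointEquiv X).symm x) ((twoPointEquiv X).symm y) ↔ Joined x y := by
  rw [homotopic_iff]
  constructor
  · rintro ⟨G, h0, h1⟩
    exact ⟨⟨(G.map ⟨true⟩).1, congrArg (twoPointEquiv X) h0, congrArg (twoPointEquiv X) h1⟩⟩
  · rintro ⟨γ⟩
    exact ⟨(twoPointEquiv (path X)).symm ⟨γ, by simp⟩, (twoPointEquiv X).injective γ.source,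
      (twoPointEquiv X).injective γ.target⟩

theorem twoPointEquiv_symm_comp (p : E ⟶ B) (x : E) :
    (twoPointEquiv E).symm x ≫ p = (twoPointEquiv B).symm (p.map x) :=
  (twoPointEquiv B).injective rfl

/-- Degree `0` for `S⁰` concerns path components; degree `0` of the loop map concerns components of
the loop space, that is, the fundamental group at the base point. -/
theorem bijectiveAt_of_weq (h : weq twoPoint p) : BijectiveAt p.map E.pt where
  joined x hx := by
    have hb : Bij twoPoint p := weq_iff.1 h 0
    refine homotopic_twoPoint_iff.1 (hb.1 _ _ ?_)
    rw [twoPointEquiv_symm_comp, twoPointEquiv_symm_comp]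
    exact homotopic_twoPoint_iff.2 hx
  loop ω := by
    have hb : Bij twoPoint (loopFunctor.map p) := weq_iff.1 h.map_loop 0
    obtain ⟨f, hf⟩ := hb.2 ((twoPointEquiv (loopFunctor.obj B)).symm
      ⟨ω, by
        rintro c (rfl | rfl)
        · exact ω.source.trans p.map_pt
        · exact ω.target.trans p.map_pt⟩)
    obtain ⟨f, rfl⟩ := (twoPointEquiv _).symm.surjective f
    rw [twoPointEquiv_symm_comp] at hf
    obtain ⟨γ⟩ := homotopic_twoPoint_iff.1 hf
    let J : C(I, relPath {0, 1} B) := γ.toContinuousMap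
    have hJ0 : ∀ t, (J 0).1 t = p.map (f.1 t) := fun t => congrArg (fun δ => δ.1 t) γ.source
    have hJ1 : ∀ t, (J 1).1 t = ω t := fun t => congrArg (fun δ => δ.1 t) γ.target
    refine ⟨⟨f.1, f.2 0 (by simp), f.2 1 (by simp)⟩, ⟨{
      toFun := fun q => (J q.1).1 q.2
      continuous_toFun := continuous_relPath_iff.1 J.continuous
      map_zero_left := hJ0
      map_one_left := hJ1
      prop' := fun t c hc => ((J t).2 c hc).trans (((J 0).2 c hc).symm.trans (hJ0 c)) }⟩⟩

/-- A lift up to homotopy can be made strict. -/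
theorem full_twoPoint (h : fib twoPoint p)
    (h' : ∀ x y (δ : Path (p.map x) (p.map y)), ∃ γ : Path x y,
      (γ.map p.map.continuous).Homotopic δ) : Full twoPoint p := by
  intro f g G hf hg
  obtain ⟨f, rfl⟩ := (twoPointEquiv _).symm.surjective f
  obtain ⟨g, rfl⟩ := (twoPointEquiv _).symm.surjective g
  obtain ⟨G, rfl⟩ := (twoPointEquiv _).symm.surjective G
  have hf' : G.1 0 = p.map f := congrArg (twoPointEquiv _) hf
  have hg' : G.1 1 = p.map g := congrArg (twoPointEquiv _) hg
  obtain ⟨γ, ⟨H⟩⟩ := h' f g ⟨G.1, hf', hg'⟩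
  let H' : path (path B) := (pathPathCurry (T := Unit) ⟨fun q => H q.2, by fun_prop⟩) ()
  let f' : twoPoint ⟶ path E := (twoPointEquiv _).symm ⟨γ, by simp⟩
  let G' : twoPoint ⟶ path (path B) := (twoPointEquiv _).symm H'
  have hG : ∀ z s, ((G'.map z).1 0).1 s = p.map ((f'.map z).1 s) := by
    rintro ⟨_ | _⟩ s
    · exact p.map_pt.symm
    · exact H.apply_zero s
  have hC : ∀ z t, ∀ c ∈ ({0, 1} : Set I), ((G'.map z).1 t).1 c = ((G'.map z).1 0).1 c := by
    rintro ⟨_ | _⟩ t c hc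
    · rfl
    · obtain rfl | rfl := hc
      · exact (H.source t).trans (H.source 0).symm
      · exact (H.target t).trans (H.target 0).symm
  -- Lift the homotopy from `p ∘ γ` to the given path, starting at `γ` and keeping both ends fixed;
  -- its final stage is the strict lift.
  obtain ⟨F, -, h1, h2⟩ := exists_lift_rel isSideDeformation_radial
    ((fib_iff.1 h).map_path.map_path 0) f' G' hG hC
  let F' : path (path E) := F.map ⟨true⟩
  refine ⟨(twoPointEquiv (path E)).symm (F'.1 1), (twoPointEquiv _).injective ?_,
    (twoPointEquiv _).injective ?_, (twoPointEquiv _).injective (relPath_ext fun t => ?_)⟩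
  · exact (h2 ⟨true⟩ 1 0 (by simp)).trans γ.source
  · exact (h2 ⟨true⟩ 1 1 (by simp)).trans γ.target
  · exact (h1 ⟨true⟩ 1 t).trans (H.apply_one t)

/-- Fullness from translations of all points to the component of the base point. -/
theorem full_twoPoint_of_translation (h : fib twoPoint p) (hw : weq twoPoint p)
    (hT : ∀ y : E, ∃ T : Translation p.map, Joined (T.R y) E.pt) : Full twoPoint p :=
  full_twoPoint h fun _ y δ => by
    obtain ⟨T, hT⟩ := hT y
    exact (bijectiveAt_of_weq hw).exists_path_of_translation T hT δ

end

/-! ### Maps out of wedges -/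

section

variable {A X Y Z : PointedTop.{u}}

theorem trivialMap_comp (f : Y ⟶ Z) : trivialMap X Y ≫ f = trivialMap X Z :=
  hom_ext fun _ => f.map_pt

theorem wedgeDesc_comp (f : X ⟶ A) (g : Y ⟶ A) (h : A ⟶ Z) :
    wedgeDesc f g ≫ h = wedgeDesc (f ≫ h) (g ≫ h) :=
  wedge_hom_ext rfl (by rw [wedgeInr_desc, ← Category.assoc, wedgeInr_desc])

theorem wedgeDesc_homotopic {f : X ⟶ Z} {g g' : Y ⟶ Z} (h : Homotopic g g') :
    Homotopic (wedgeDesc f g) (wedgeDesc f g') := by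
  obtain ⟨G, rfl, rfl⟩ := homotopic_iff.1 h
  exact homotopic_iff.2 ⟨wedgeDesc (f ≫ constPath Z) G, by rw [wedgeDesc_comp]; rfl,
    by rw [wedgeDesc_comp]; rfl⟩

/-- A proper map stays closed after taking the product with any space. Thus the quotient map onto a
wedge remains a quotient map after multiplication with a mapping space, which need not be locally
compact. -/
theorem isProperMap_collapseMk {Y : Type u} [TopologicalSpace Y] [T1Space Y] {S : Set Y}
    {s : Y} (hs : s ∈ S) (hS : S.Finite) : IsProperMap (collapseMk hs) := by
  have key : ∀ y z, collapseMk hs y = collapseMk hs z ↔ y = z ∨ (y ∈ S ∧ z ∈ S) :=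
    fun y z => Quotient.eq (r := collapseSetoid S)
  rw [isProperMap_iff_isClosedMap_and_compact_fibers]
  refine ⟨(collapseMk hs).continuous, fun K hK => ?_, fun z => ?_⟩
  · have hq : Topology.IsQuotientMap (collapseMk hs) := isQuotientMap_quotient_mk'
    rw [← hq.isClosed_preimage]
    by_cases h : (K ∩ S).Nonempty
    · obtain ⟨k, hk, hkS⟩ := h
      convert! hK.union hS.isClosed using 1
      ext y
      constructor
      · rintro ⟨k, hk, hky⟩
        obtain rfl | ⟨-, h⟩ := (key _ _).1 hky
        · exact Or.inl hk
        · exact Or.inr h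
      · rintro (h | h)
        · exact ⟨y, h, rfl⟩
        · exact ⟨k, hk, (key _ _).2 (Or.inr ⟨hkS, h⟩)⟩
    · convert! hK using 1
      ext y
      constructor
      · rintro ⟨k, hk, hky⟩
        obtain rfl | ⟨h', -⟩ := (key _ _).1 hky
        · exact hk
        · exact (h ⟨k, hk, h'⟩).elim
      · exact fun h => ⟨y, h, rfl⟩
  · obtain ⟨z, rfl⟩ := collapseMk_surjective z
    refine ((hS.insert z).subset ?_).isCompact
    intro y hy
    obtain rfl | ⟨h, -⟩ := (key _ _).1 hy
    · exact Or.inl rfl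
    · exact Or.inr h

theorem continuous_wedgeDesc [T2Space A] [T2Space Y] [LocallyCompactSpace A] (y : Y ⟶ X) :
    Continuous fun q : mapSpace A X × wedge A Y => (wedgeDesc (Z := X) q.1 y).map q.2 := by
  have hs : Sum.inl A.pt ∈ ({Sum.inl A.pt, Sum.inr Y.pt} : Set (A ⊕ Y)) := Or.inl rfl
  have hq : Topology.IsQuotientMap
      (Prod.map (id : mapSpace A X → mapSpace A X) (collapseMk hs)) :=
    ((isProperMap_id (X := mapSpace A X)).prodMap
      (isProperMap_collapseMk hs (Set.toFinite _))).isClosedMap.isQuotientMap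
      (continuous_id.prodMap (collapseMk hs).continuous)
      (Function.surjective_id.prodMap collapseMk_surjective)
  refine hq.continuous_iff.2 ?_
  let e := (Homeomorph.prodSumDistrib (X := mapSpace A X) (Y := A) (Z := Y))
  rw [← e.symm.comp_continuous_iff']
  refine continuous_sum_dom.2 ⟨?_, ?_⟩
  · exact Continuous.mapSpace_apply continuous_fst continuous_snd
  · exact y.map.continuous.comp continuous_snd

end

/-! ### Translations of the space of maps from an H-cogroup -/

section

variable {A E B X : PointedTop.{u}} [LocallyCompactSpace A]

theorem joined_mapSpace_iff {f g : A ⟶ X} :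
    Joined (X := mapSpace A X) f g ↔ Homotopic f g :=
  homotopic_twoPoint_iff.symm.trans ((mapSpaceExchange A).homotopic_iff f g).symm

variable [T2Space A]

/-- The map `x ↦ (x, y) ∘ u` on spaces of maps. -/
def wedgeTranslation (u : A ⟶ wedge A A) (y : A ⟶ X) : C(mapSpace A X, mapSpace A X) :=
  ⟨fun x : A ⟶ X => u ≫ wedgeDesc x y, continuous_mapSpace_iff.2
    ((continuous_wedgeDesc y).comp
      (continuous_fst.prodMk (u.map.continuous.comp continuous_snd)))⟩

/-- The homotopy of translations given by a homotopy of maps into the wedge. -/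
def wedgeHomotopy (G : A ⟶ path (wedge A A)) (y : A ⟶ X) :
    C(I × mapSpace A X, mapSpace A X) :=
  ⟨fun q => ((G ≫ pathEv _ q.1) ≫ wedgeDesc (Z := X) q.2 y : A ⟶ X),
    continuous_mapSpace_iff.2 ((continuous_wedgeDesc y).comp
      ((continuous_snd.comp continuous_fst).prodMk (Continuous.relPath_apply
        (G.map.continuous.comp continuous_snd) (continuous_fst.comp continuous_fst))))⟩

/-- Writing `ν` additively, `R x = x - y` and `R' x = x + y`, and `S`, `S'` are the same with `p ∘
y`. The homotopy from `(x - y) + y` to `x` comes from a single universal homotopy of maps `A ⟶ A ∨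
A`, so it commutes strictly with postcomposition by `p`. -/
theorem exists_translation (hA : IsHCogroup A) (p : E ⟶ B) (y : A ⟶ E) :
    ∃ T : Translation ((homFunctor A).map p).map, Joined (T.R y) (mapSpace A E).pt := by
  obtain ⟨ν, τ, h1, -, h3, h4, h5⟩ := hA
  let θ : A ⟶ wedge A A := ν ≫ wedgeDesc (wedgeInl A A) (τ ≫ wedgeInr A A)
  -- The chain `(x - y) + y ≃ x + (-y + y) ≃ x + 0 ≃ x`, with `x` and `y` the two inclusions:
  -- coassociativity, coinverse, counit.
  have hθ : Homotopic (ν ≫ wedgeDesc θ (wedgeInr A A)) (wedgeInl A A) := by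
    have e1 := h3.comp_right
      (wedgeDesc (wedgeInl A A) (wedgeDesc (τ ≫ wedgeInr A A) (wedgeInr A A)))
    have e2 := (wedgeDesc_homotopic (f := wedgeInl A A)
      (h5.comp_right (wedgeInr A A))).comp_left ν
    have e3 := h1.comp_right (wedgeInl A A)
    simp only [Category.assoc, wedgeDesc_comp, wedgeInl_desc, wedgeInr_desc,
      trivialMap_comp, Category.id_comp] at e1 e2 e3
    exact (e1.trans e2).trans e3
  obtain ⟨G, h0, h1⟩ := homotopic_iff.1 hθ
  have hR (X : PointedTop.{u}) (y : A ⟶ X) (x : A ⟶ X) :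
      (G ≫ pathEv _ 0) ≫ wedgeDesc x y = ν ≫ wedgeDesc (θ ≫ wedgeDesc x y) y := by
    rw [h0, Category.assoc, wedgeDesc_comp, wedgeInr_desc]
  have hR' (X : PointedTop.{u}) (y : A ⟶ X) (x : A ⟶ X) :
      (G ≫ pathEv _ 1) ≫ wedgeDesc x y = x := by
    rw [h1, wedgeInl_desc]
  have hp (u : A ⟶ wedge A A) (x : A ⟶ E) :
      (u ≫ wedgeDesc x y) ≫ p = u ≫ wedgeDesc (x ≫ p) (y ≫ p) := by
    rw [Category.assoc, wedgeDesc_comp]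
  refine ⟨{
    R := wedgeTranslation θ y
    R' := wedgeTranslation ν y
    S := wedgeTranslation θ (y ≫ p)
    S' := wedgeTranslation ν (y ≫ p)
    map_R := hp θ
    map_R' := hp ν
    h := ⟨wedgeHomotopy G y, hR E y, hR' E y⟩
    k := ⟨wedgeHomotopy G (y ≫ p), hR B (y ≫ p), hR' B (y ≫ p)⟩
    map_h := fun q => hp (G ≫ pathEv _ q.1) q.2 }, ?_⟩
  refine joined_mapSpace_iff.2 ?_
  -- This is `y - y ≃ 0`, which puts `R y` in the component of the constant map.
  have := h4.comp_right y
  simp only [Category.assoc, wedgeDesc_comp, Category.id_comp, trivialMap_comp] at this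
  change Homotopic (θ ≫ wedgeDesc y y) (trivialMap A E)
  simpa only [θ, Category.assoc, wedgeDesc_comp, wedgeInl_desc, wedgeInr_desc] using this

/-- Homotopies of maps from an H-cogroup lift along trivial fibrations, with prescribed ends. -/
theorem IsHCogroup.full (hA : IsHCogroup A) (p : E ⟶ B) (hp : fib A p) (hw : weq A p) :
    Full A p :=
  ((mapSpaceExchange A).full_iff p).2 (full_twoPoint_of_translation
    ((mapSpaceExchange A).fib_iff.1 hp) ((mapSpaceExchange A).weq_iff.1 hw)
    (exists_translation hA p))

theorem IsHCogroup.isModelStructure (hA : IsHCogroup A) :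
    IsModelStructure (fib A) (cof A) (weq A) :=
  PointedTop.isModelStructure fun p hp hw => hA.full p hp hw

end

/-! ### Maps out of the circle -/

section

variable {X Y : PointedTop.{u}}

/-- The parametrization of the circle by the unit interval. -/
noncomputable def circleLoop : C(I, circle.{u}) :=
  ⟨fun t => ⟨Circle.exp (2 * Real.pi * t)⟩, by fun_prop⟩

theorem circleLoop_zero : circleLoop 0 = circle.{u}.pt :=
  congrArg ULift.up (by simp)

theorem circleLoop_one : circleLoop 1 = circle.{u}.pt :=
  congrArg ULift.up (by simp)

theorem circleLoop_eq_iff {s t : I} (h : circleLoop.{u} s = circleLoop t) :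
    s = t ∨ (s ∈ ({0, 1} : Set I) ∧ t ∈ ({0, 1} : Set I)) := by
  obtain ⟨m, hm⟩ := Circle.exp_eq_exp.1 (congrArg ULift.down h)
  have hπ := Real.pi_pos
  have hm' : (s : ℝ) = t + m := by
    have : (2 * Real.pi) * (s : ℝ) = (2 * Real.pi) * (t + m) := by rw [hm]; ring
    exact mul_left_cancel₀ (by positivity) this
  obtain ⟨hs0, hs1⟩ := s.2
  obtain ⟨ht0, ht1⟩ := t.2
  have h1 : (m : ℝ) < 2 := by linarith
  have h2 : (-2 : ℝ) < m := by linarith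
  have h1' : m < 2 := by exact_mod_cast h1
  have h2' : -2 < m := by exact_mod_cast h2
  obtain rfl | rfl | rfl : m = 0 ∨ m = 1 ∨ m = -1 := by omega
  · left; ext; simpa using hm'
  · right
    push_cast at hm'
    exact ⟨Or.inr (Subtype.ext (show (s : ℝ) = 1 by linarith)),
      Or.inl (Subtype.ext (show (t : ℝ) = 0 by linarith))⟩
  · right
    push_cast at hm'
    exact ⟨Or.inl (Subtype.ext (show (s : ℝ) = 0 by linarith)),
      Or.inr (Subtype.ext (show (t : ℝ) = 1 by linarith))⟩

theorem circleLoop_surjective : Function.Surjective circleLoop.{u} := by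
  rintro ⟨z⟩
  have hπ := Real.pi_pos
  have h1 := Complex.neg_pi_lt_arg (z : ℂ)
  have h2 := Complex.arg_le_pi (z : ℂ)
  by_cases h : 0 ≤ Complex.arg z
  · refine ⟨⟨Complex.arg z / (2 * Real.pi), by positivity, ?_⟩, congrArg ULift.up ?_⟩
    · rw [div_le_one (by positivity)]; linarith
    · change Circle.exp (2 * Real.pi * (Complex.arg z / (2 * Real.pi))) = z
      rw [mul_div_cancel₀ _ (by positivity), Circle.exp_arg]
  · refine ⟨⟨(Complex.arg z + 2 * Real.pi) / (2 * Real.pi), ?_, ?_⟩, congrArg ULift.up ?_⟩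
    · apply div_nonneg <;> linarith
    · rw [div_le_one (by positivity)]; linarith
    · change Circle.exp (2 * Real.pi * ((Complex.arg z + 2 * Real.pi) / (2 * Real.pi))) = z
      rw [mul_div_cancel₀ _ (by positivity), Circle.periodic_exp, Circle.exp_arg]

instance : CompactSpace circle.{u} := inferInstanceAs (CompactSpace (ULift Circle))

instance : T2Space circle.{u} := inferInstanceAs (T2Space (ULift Circle))

theorem isQuotientMap_circleLoop : Topology.IsQuotientMap circleLoop.{u} :=
  circleLoop.continuous.isClosedMap.isQuotientMap circleLoop.continuous circleLoop_surjective

theorem loop_apply_eq (γ : relPath {0, 1} X) (s t : I) (h : circleLoop.{u} s = circleLoop t) :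
    γ.1 s = γ.1 t := by
  obtain rfl | ⟨hs, ht⟩ := circleLoop_eq_iff h
  · rfl
  · exact (γ.2 s hs).trans (γ.2 t ht).symm

/-- The map out of the circle given by a loop. -/
noncomputable def ofLoop (γ : relPath {0, 1} X) : circle ⟶ X :=
  ⟨isQuotientMap_circleLoop.lift γ.1 (loop_apply_eq γ), by
    rw [← circleLoop_zero]
    exact (DFunLike.congr_fun (isQuotientMap_circleLoop.lift_comp γ.1 (loop_apply_eq γ)) 0).trans
      (γ.2 0 (by simp))⟩

theorem ofLoop_circleLoop (γ : relPath {0, 1} X) (t : I) :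
    (ofLoop γ).map (circleLoop t) = γ.1 t :=
  DFunLike.congr_fun (isQuotientMap_circleLoop.lift_comp γ.1 (loop_apply_eq γ)) t

/-- Maps out of the circle are loops. -/
noncomputable def circleEquiv (X : PointedTop.{u}) : (circle ⟶ X) ≃ loopFunctor.obj X where
  toFun f := ⟨f.map.comp circleLoop, by
    rintro c (rfl | rfl)
    · exact (congrArg f.map circleLoop_zero).trans f.map_pt
    · exact (congrArg f.map circleLoop_one).trans f.map_pt⟩
  invFun := ofLoop
  left_inv f := hom_ext fun z => by
    obtain ⟨t, rfl⟩ := circleLoop_surjective z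
    exact ofLoop_circleLoop _ t
  right_inv γ := relPath_ext (ofLoop_circleLoop γ)

/-- Pointed maps from the circle are points of the loop space. -/
noncomputable def circleExchange : Exchange circle.{u} twoPoint loopFunctor where
  toPathComm := relPathComm {0, 1}
  equiv X := (circleEquiv X).trans (twoPointEquiv (loopFunctor.obj X)).symm
  equiv_comp _ _ := (twoPointEquiv _).injective rfl

/-- The loop of a map from the circle. -/
noncomputable def loopOf (f : circle ⟶ X) : Path X.pt X.pt :=
  ⟨((circleEquiv X) f).1, (circleEquiv X f).2 0 (by simp), (circleEquiv X f).2 1 (by simp)⟩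

theorem loopOf_comp (f : circle ⟶ X) (g : X ⟶ Y) :
    loopOf (f ≫ g) = ((loopOf f).map g.map.continuous).cast g.map_pt.symm g.map_pt.symm := rfl

theorem loopOf_surjective : Function.Surjective (loopOf (X := X)) := fun γ =>
  ⟨(circleEquiv X).symm ⟨γ, by simp⟩, Path.ext (congrArg (fun δ : relPath {0, 1} X => ⇑δ.1)
    ((circleEquiv X).apply_symm_apply ⟨γ, by simp⟩))⟩

theorem homotopic_circle_iff {f g : circle ⟶ X} :
    Homotopic f g ↔ (loopOf f).Homotopic (loopOf g) := by
  rw [circleExchange.homotopic_iff]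
  refine homotopic_twoPoint_iff.trans ?_
  constructor
  · rintro ⟨γ⟩
    let J : C(I, relPath {0, 1} X) := γ.toContinuousMap
    have hJ0 : ∀ t, (J 0).1 t = loopOf f t := fun t => congrArg (fun δ => δ.1 t) γ.source
    have hJ1 : ∀ t, (J 1).1 t = loopOf g t := fun t => congrArg (fun δ => δ.1 t) γ.target
    exact ⟨{
      toFun := fun q => (J q.1).1 q.2
      continuous_toFun := continuous_relPath_iff.1 J.continuous
      map_zero_left := hJ0
      map_one_left := hJ1
      prop' := fun t c hc => ((J t).2 c hc).trans (((J 0).2 c hc).symm.trans (hJ0 c)) }⟩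
  · rintro ⟨H⟩
    have hH : ∀ s, ∀ c ∈ ({0, 1} : Set I), H (s, c) = X.pt := by
      rintro s c (rfl | rfl)
      · exact H.source s
      · exact H.target s
    let J (s : I) : relPath {0, 1} X := ⟨⟨fun t => H (s, t), by fun_prop⟩, hH s⟩
    exact ⟨⟨⟨J, continuous_relPath_iff.2 H.continuous⟩, relPath_ext H.apply_zero,
      relPath_ext H.apply_one⟩⟩

/-- Maps out of the circle are loops. Take `ν` to be the concatenation of the two inclusions and `τ`
the reversed identity loop; each law becomes a standard homotopy of paths. -/
theorem isHCogroup_circle : IsHCogroup circle.{u} := by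
  obtain ⟨ν, hν⟩ := loopOf_surjective
    ((loopOf (wedgeInl circle.{u} circle)).trans (loopOf (wedgeInr circle.{u} circle)))
  obtain ⟨τ, hτ⟩ := loopOf_surjective (loopOf (𝟙 circle.{u})).symm
  have key {X : PointedTop.{u}} (f g : circle ⟶ X) :
      loopOf (ν ≫ wedgeDesc f g) = (loopOf f).trans (loopOf g) := by
    rw [loopOf_comp, hν, Path.map_trans]
    ext t
    simp only [Path.trans_apply, Path.cast_coe]
    split_ifs <;> rfl
  have triv : loopOf (trivialMap circle circle.{u}) = Path.refl _ := rfl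
  refine ⟨ν, τ, ?_, ?_, ?_, ?_, ?_⟩ <;> rw [homotopic_circle_iff]
  · rw [key, triv]
    exact .trans_refl _
  · rw [key, triv]
    exact .refl_trans _
  · have e : loopOf (ν ≫ wedgeInr circle.{u} (wedge circle circle)) =
        (loopOf (wedgeInl circle.{u} circle ≫ wedgeInr circle (wedge circle circle))).trans
        (loopOf (wedgeInr circle.{u} circle ≫ wedgeInr circle (wedge circle circle))) := by
      rw [← key]
      congr 2
      exact wedge_hom_ext rfl rfl
    rw [key, key, key, e]
    exact .trans_assoc _ _ _
  · rw [key, hτ, triv]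
    exact .trans_symm _
  · rw [key, hτ, triv]
    exact .symm_trans _

end

/-! ### The Quillen adjunction -/

section

variable {A X Y : PointedTop.{u}} [LocallyCompactSpace A]

/-- Both sides are conditions relative to `S⁰`: the hypothesis on `Hom(A, p)`, the conclusion on its
loop map. -/
theorem fib.map_hom {p : X ⟶ Y} (h : fib A p) : fib circle ((homFunctor A).map p) :=
  circleExchange.fib_iff.2 ((mapSpaceExchange A).fib_iff.1 h).map_loop

theorem weq.map_hom {p : X ⟶ Y} (h : weq A p) : weq circle ((homFunctor A).map p) :=
  circleExchange.weq_iff.2 ((mapSpaceExchange A).weq_iff.1 h).map_loop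

end

end PointedTop

/-- An adjunction between model categories is a Quillen adjunction if its right adjoint preserves
fibrations and weak equivalences. -/
theorem isQuillenAdjunction_of_right {C D : Type*} [Category C] [Category D]
    {F K W : MorphismProperty C} {F' K' W' : MorphismProperty D}
    {L : C ⥤ D} {R : D ⥤ C} (adj : L ⊣ R) (h : IsModelStructure F K W)
    (h' : IsModelStructure F' K' W') (hF : ∀ ⦃X Y : D⦄ (f : X ⟶ Y), F' f → F (R.map f))
    (hW : ∀ ⦃X Y : D⦄ (f : X ⟶ Y), W' f → W (R.map f)) :
    IsQuillenAdjunction F K W F' K' W' adj := by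
  obtain ⟨_, hF₁, hK₁, hW₁⟩ := id h
  obtain ⟨_, hF₂, hK₂, hW₂⟩ := id h'
  -- In both categories the cofibrations and the trivial cofibrations are left lifting classes, so
  -- their preservation by `L` is adjoint to what is assumed about `R`.
  have e1 : K = (F ⊓ W).llp := by
    rw [← hF₁, ← hK₁, ← hW₁]
    exact (HomotopicalAlgebra.trivialFibrations_llp C).symm
  have e2 : K ⊓ W = F.llp := by
    rw [← hF₁, ← hK₁, ← hW₁]
    exact (HomotopicalAlgebra.fibrations_llp C).symm
  have e1' : K' = (F' ⊓ W').llp := by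
    rw [← hF₂, ← hK₂, ← hW₂]
    exact (HomotopicalAlgebra.trivialFibrations_llp D).symm
  have e2' : K' ⊓ W' = F'.llp := by
    rw [← hF₂, ← hK₂, ← hW₂]
    exact (HomotopicalAlgebra.fibrations_llp D).symm
  refine ⟨h, h', fun X Y f hf => ?_, fun X Y f hf => ?_, hF,
    fun X Y f hf => ⟨hF f hf.1, hW f hf.2⟩⟩
  · rw [e1] at hf
    rw [e1']
    exact fun _ _ p hp => (adj.hasLiftingProperty_iff f p).2 (hf _ ⟨hF p hp.1, hW p hp.2⟩)
  · rw [e2] at hf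
    rw [e2']
    exact fun _ _ p hp => (adj.hasLiftingProperty_iff f p).2 (hf _ (hF p hp))

theorem mainTheorem6 (A : PointedTop.{u}) [CompactSpace A] [T2Space A]
    (hA : PointedTop.IsHCogroup A) :
    IsQuillenAdjunction
      (PointedTop.fib PointedTop.circle.{u}) (PointedTop.cof PointedTop.circle.{u})
      (PointedTop.weq PointedTop.circle.{u})
      (PointedTop.fib A) (PointedTop.cof A) (PointedTop.weq A)
      (PointedTop.smashHomAdjunction A) ∧
    (∀ ⦃X Y : PointedTop.{u}⦄ (p : X ⟶ Y), PointedTop.fib A p →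
      PointedTop.fib PointedTop.circle.{u} ((PointedTop.homFunctor A).map p)) ∧
    (∀ ⦃X Y : PointedTop.{u}⦄ (g : X ⟶ Y), PointedTop.weq A g →
      PointedTop.weq PointedTop.circle.{u} ((PointedTop.homFunctor A).map g)) :=
  ⟨isQuillenAdjunction_of_right _ PointedTop.isHCogroup_circle.isModelStructure
    hA.isModelStructure (fun _ _ _ hp => hp.map_hom) (fun _ _ _ hg => hg.map_hom),
    fun _ _ _ hp => hp.map_hom, fun _ _ _ hg => hg.map_hom⟩
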